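/- Let $n\ge 0$ and let $r=\{r_{ij}\}_{0\le i\le j\le n}$ be non-negative integers such that $r_{ij}\le\min(r_{i,j-1},r_{i+1,j})$ for $0\le i<j\le n$ and $r_{ij}+r_{i-1,j+1}\ge r_{i-1,j}+r_{i,j+1}$ for $0<i\le j<n$ (rank conditions that can occur). Put $e_i=r_{ii}$, extend $r$ by $r_{ij}=e_j+e_{j+1}+\dots+e_i$ for $j\le i$, and put $N=r_{n0}=e_0+\dots+e_n$. For $0\le i<n$ and $0<j\le n$ let $W_{ij}\in S_N$ be the permutation with $W_{ij}(p)=p+r_{i,j-1}-r_{ij}$ if $r_{ij}<p\le r_{i+1,j}$, $W_{ij}(p)=p-r_{i+1,j}+r_{ij}$ if $r_{i+1,j}<p\le r_{i+1,j}+r_{i,j-1}-r_{ij}$, and $W_{ij}(p)=p$ otherwise. Let $z(r)=\prod_{j=1}^n\prod_{i=0}^{n-1}W_{ij}$ (factors in this order from left to right) and let $\hat z(r)=w_0\,z(r)^{-1}w_0$ be the Zelevinsky permutation, where $w_0$ is the longest permutation in $S_N$. Let $\hat z(e)=\hat z(r^e)$ for the maximal rank conditions $r^e_{ij}=\min\{e_i,\dots,e_j\}$,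 $i\le j$. For $w\in S_N$ let $\mathfrak G_w(x;y)$ be the double Grothendieck (Laurent) polynomial in $x_1,\dots,x_N$, $y_1,\dots,y_N$: $\mathfrak G_{w_0}=\prod_{p+q\le N}(1-y_p/x_q)$, and $(x_i-x_{i+1})\,\mathfrak G_w=x_i\,\mathfrak G_{ws_i}-x_{i+1}\,s_i(\mathfrak G_{ws_i})$ whenever $w(i)<w(i+1)$, where $s_i$ acts on Laurent polynomials by interchanging $x_i$ and $x_{i+1}$. Let $a^i=(a^i_1,\dots,a^i_{e_i})$ and $b^i=(b^i_1,\dots,b^i_{e_i})$, $0\le i\le n$, be independent variables, and put $\breve a=(a^n,a^{n-1},\dots,a^0)$ and $b=(b^0,b^1,\dots,b^n)$. Then $\mathfrak G_{\hat z(e)}(\breve a;b)\ne 0$, and the double quiver polynomial $$K_r(a;b)=\frac{\mathfrak G_{\hat z(r)}(\breve a;b)}{\mathfrak G_{\hat z(e)}(\breve a;b)}$$ is a Laurent polynomial with integer coefficients. It is multi-supersymmetric: for every $0\le i<n$ with $e_i,e_{i+1}\ge 1$, if one sets $a^{i+1}_1=b^i_1$ in $K_r(a;b)$, then the result is independent of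 this common variable, that is, the variable does not occur in it. -/

import Mathlib

/-- The variables `a^i_j` and `b^i_j`, indexed as in the usual notation by `i ≥ 0` and `j ≥ 1`
(the variables with `j = 0` are never used). -/
inductive QVar : Type
  | a (i j : ℕ) : QVar
  | b (i j : ℕ) : QVar
  deriving DecidableEq

/-- The field of rational functions over `ℚ` in the variables `a^i_j`, `b^i_j`
(the fraction field of the polynomial ring over `ℤ`). -/
abbrev QRat : Type := FractionRing (MvPolynomial QVar ℤ)

/-- The ring of Laurent polynomials with integer coefficients in the variables `a^i_j`, `b^i_j`:
the group ring of the free abelian group of exponent vectors. -/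
abbrev QLaurent : Type := AddMonoidAlgebra ℤ (QVar →₀ ℤ)

/-- A variable, as a rational function. -/
noncomputable def qX (v : QVar) : QRat :=
  algebraMap (MvPolynomial QVar ℤ) QRat (MvPolynomial.X v)

theorem qX_ne_zero (v : QVar) : qX v ≠ 0 := by
  intro h
  have h' := (IsFractionRing.injective (MvPolynomial QVar ℤ) QRat) (h.trans (map_zero _).symm)
  exact MvPolynomial.X_ne_zero v h'

/-- The Laurent monomial with a given exponent vector, as a rational function. -/
noncomputable def qMonomial : Multiplicative (QVar →₀ ℤ) →* QRat where
  toFun m := (Multiplicative.toAdd m).prod fun v k => qX v ^ k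
  map_one' := by simp
  map_mul' m m' := by
    rw [toAdd_mul]
    exact Finsupp.prod_add_index' (fun v => zpow_zero _)
      (fun v k l => zpow_add₀ (qX_ne_zero v) k l)

/-- The (injective) inclusion of the Laurent polynomials in the rational functions. -/
noncomputable def QLaurent.toRat : QLaurent →ₐ[ℤ] QRat :=
  AddMonoidAlgebra.lift ℤ QRat (QVar →₀ ℤ) qMonomial

/-- Substitute the variable `v` for the variable `u` in a Laurent polynomial. -/
noncomputable def QLaurent.setVar (u v : QVar) : QLaurent →+* QLaurent :=
  AddMonoidAlgebra.mapDomainRingHom ℤ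
    (Finsupp.mapDomain.addMonoidHom (fun t => if t = u then v else t))

/-- The Laurent polynomial `P` does not involve the variable `v`. -/
def QLaurent.IndependentOf (P : QLaurent) (v : QVar) : Prop :=
  ∀ m ∈ P.coeff.support, m v = 0

/-- Interchange the variables `u` and `v` in a rational function. -/
noncomputable def qSwap (u v : QVar) : QRat ≃+* QRat :=
  IsFractionRing.ringEquivOfRingEquiv
    (MvPolynomial.renameEquiv ℤ (Equiv.swap u v)).toRingEquiv

/-! Permutations of `{1, …, N}` are represented by permutations of `ℕ` fixing all other numbers;
the product of permutations is composition. -/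

/-- The number of non-inversions of `w` in `{1, …, N}`. -/
def nonInv (N : ℕ) (w : Equiv.Perm ℕ) : ℕ :=
  ((Finset.Icc 1 N ×ˢ Finset.Icc 1 N).filter fun t => t.1 < t.2 ∧ w t.1 < w t.2).card

/-- The set of ascent positions of `w` in `{1, …, N - 1}`. -/
def ascents (N : ℕ) (w : Equiv.Perm ℕ) : Finset ℕ :=
  (Finset.Ico 1 N).filter fun i => w i < w (i + 1)

theorem nonInv_lt (N i : ℕ) (w : Equiv.Perm ℕ) (h : i ∈ ascents N w) :
    nonInv N (w * Equiv.swap i (i + 1)) < nonInv N w := by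
  obtain ⟨⟨h1, h2⟩, h3⟩ : (1 ≤ i ∧ i < N) ∧ w i < w (i + 1) := by
    simpa [ascents] using h
  have hs : ∀ p, Equiv.swap i (i + 1) p = if p = i then i + 1 else if p = i + 1 then i else p :=
    fun p => Equiv.swap_apply_def i (i + 1) p
  unfold nonInv
  refine lt_of_le_of_lt (Finset.card_le_card_of_injOn
    (t := ((Finset.Icc 1 N ×ˢ Finset.Icc 1 N).filter
      fun t => t.1 < t.2 ∧ w t.1 < w t.2).erase (i, i + 1))
    (fun t => (Equiv.swap i (i + 1) t.1, Equiv.swap i (i + 1) t.2)) ?_ ?_)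
    (Finset.card_erase_lt_of_mem ?_)
  · rintro ⟨p, q⟩ hpq
    simp only [Finset.coe_filter, Finset.mem_product, Finset.mem_Icc, Set.mem_ofPred_eq,
      Equiv.Perm.mul_apply, Finset.coe_erase, Set.mem_sdiff, Set.mem_singleton_iff,
      Prod.mk.injEq, hs] at hpq ⊢
    grind
  · intro t _ u _ htu
    simpa [Prod.ext_iff] using htu
  · simp only [Finset.mem_filter, Finset.mem_product, Finset.mem_Icc]
    omega

/-- The double Grothendieck (Laurent) polynomial `𝔊_w(x; y)` of Lascoux and Schützenberger, for
`w ∈ S_N` and sequences `x_1, …, x_N` and `y_1, …, y_N` of distinct variables: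
`𝔊_w = ∏_{p + q ≤ N} (1 - y_p / x_q)` for the longest permutation `w` (the one without ascents),
and `(x_i - x_{i+1}) 𝔊_w = x_i 𝔊_{w s_i} - x_{i+1} 𝔊_{w s_i}(x_{s_i}; y)` for an ascent
`w(i) < w(i+1)` (the first ascent is used; the result is the same for every ascent). -/
noncomputable def grothendieck (N : ℕ) (x y : ℕ → QVar) (w : Equiv.Perm ℕ) : QRat :=
  if h : (ascents N w).Nonempty then
    let i := (ascents N w).min' h
    let g := grothendieck N x y (w * Equiv.swap i (i + 1))
    (qX (x i) * g - qX (x (i + 1)) * qSwap (x i) (x (i + 1)) g) / (qX (x i) - qX (x (i + 1)))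
  else
    ∏ t ∈ (Finset.Icc 1 N ×ˢ Finset.Icc 1 N).filter (fun t => t.1 + t.2 ≤ N),
      (1 - qX (y t.1) / qX (x t.2))
termination_by nonInv N w
decreasing_by exact nonInv_lt N _ w (Finset.min'_mem _ h)

/-- The numbers `r i j`, `0 ≤ i ≤ j ≤ n`, are rank conditions which can occur
(for a sequence of `n + 1` vector bundles, or vector spaces, of dimensions `r i i`). Values of `r`
outside of this range play no role. -/
structure IsRankConditions (n : ℕ) (r : ℕ → ℕ → ℕ) : Prop where
  le_left : ∀ i j, i < j → j ≤ n → r i j ≤ r i (j - 1)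
  le_right : ∀ i j, i < j → j ≤ n → r i j ≤ r (i + 1) j
  le_add : ∀ i j, 0 < i → i ≤ j → j < n →
    r (i - 1) j + r i (j + 1) ≤ r i j + r (i - 1) (j + 1)

/-- The extension of rank conditions by `r_{ij} = e_j + e_{j+1} + ⋯ + e_i` for `j ≤ i`,
where `e_k = r_{kk}`. -/
def rankExt (r : ℕ → ℕ → ℕ) (i j : ℕ) : ℕ :=
  if j ≤ i then ∑ k ∈ Finset.Icc j i, r k k else r i j

/-- The maximal rank conditions `r^e` with the same dimension vector `e` as `r`, that is
`r^e_{ij} = min {e_i, …, e_j}` for `i ≤ j`. -/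
noncomputable def maxRank (r : ℕ → ℕ → ℕ) (i j : ℕ) : ℕ :=
  sInf ((fun k => r k k) '' Set.Icc i j)

/-- The permutation which maps `p` to `p + x` for `c < p ≤ c + y`, and to `p - y` for
`c + y < p ≤ c + y + x`, and which fixes all other `p`. -/
def blockSwap (c x y : ℕ) : Equiv.Perm ℕ where
  toFun p := if c < p ∧ p ≤ c + y then p + x
    else if c + y < p ∧ p ≤ c + y + x then p - y else p
  invFun p := if c < p ∧ p ≤ c + x then p + y
    else if c + x < p ∧ p ≤ c + x + y then p - x else p
  left_inv p := by grind
  right_inv p := by grind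

/-- The permutation `W_{ij}`: it maps `p` to `p + r_{i,j-1} - r_{ij}` for
`r_{ij} < p ≤ r_{i+1,j}`, and to `p - r_{i+1,j} + r_{ij}` for
`r_{i+1,j} < p ≤ r_{i+1,j} + r_{i,j-1} - r_{ij}`, and it fixes all other `p`. -/
def zelBlock (r : ℕ → ℕ → ℕ) (i j : ℕ) : Equiv.Perm ℕ :=
  blockSwap (rankExt r i j) (rankExt r i (j - 1) - rankExt r i j)
    (rankExt r (i + 1) j - rankExt r i j)

/-- The conjugate Zelevinsky permutation
`z(r) = ∏_{j=1}^n ∏_{i=0}^{n-1} W_{ij}` (the factors in this order from left to right). -/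
def conjZel (n : ℕ) (r : ℕ → ℕ → ℕ) : Equiv.Perm ℕ :=
  ((List.range n).map fun j => ((List.range n).map fun i => zelBlock r i (j + 1)).prod).prod

/-- The longest permutation `p ↦ N + 1 - p` of `{1, …, N}`. -/
def longestPerm (N : ℕ) : Equiv.Perm ℕ where
  toFun p := if 1 ≤ p ∧ p ≤ N then N + 1 - p else p
  invFun p := if 1 ≤ p ∧ p ≤ N then N + 1 - p else p
  left_inv p := by grind
  right_inv p := by grind

/-- `N = e_0 + ⋯ + e_n`. -/
def totalDim (n : ℕ) (r : ℕ → ℕ → ℕ) : ℕ := rankExt r n 0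

/-- The Zelevinsky permutation `w_0 z(r)⁻¹ w_0`, where `w_0` is the longest permutation in `S_N`. -/
def zel (n : ℕ) (r : ℕ → ℕ → ℕ) : Equiv.Perm ℕ :=
  longestPerm (totalDim n r) * (conjZel n r)⁻¹ * longestPerm (totalDim n r)

/-- A finite list of variables as a sequence, with numbering from 1 (and a dummy value outside
of the range). -/
def seqOfList (l : List QVar) (p : ℕ) : QVar := l.getD (p - 1) (QVar.a 0 0)

/-- The sequence `ă = (a^n_1, …, a^n_{e_n}, …, a^0_1, …, a^0_{e_0})`. -/
def aRev (n : ℕ) (r : ℕ → ℕ → ℕ) : ℕ → QVar :=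
  seqOfList ((List.range (n + 1)).reverse.flatMap fun i =>
    (List.range (r i i)).map fun j => QVar.a i (j + 1))

/-- The sequence `b = (b^0_1, …, b^0_{e_0}, …, b^n_1, …, b^n_{e_n})`. -/
def bSeq (n : ℕ) (r : ℕ → ℕ → ℕ) : ℕ → QVar :=
  seqOfList ((List.range (n + 1)).flatMap fun i =>
    (List.range (r i i)).map fun j => QVar.b i (j + 1))

/-- The numerator `𝔊_{ẑ(r)}(ă; b)` of the double ratio formula. -/
noncomputable def ratioNum (n : ℕ) (r : ℕ → ℕ → ℕ) : QRat :=
  grothendieck (totalDim n r) (aRev n r) (bSeq n r) (zel n r)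

/-- The denominator `𝔊_{ẑ(e)}(ă; b)` of the double ratio formula, where `ẑ(e) = ẑ(r^e)`. -/
noncomputable def ratioDen (n : ℕ) (r : ℕ → ℕ → ℕ) : QRat :=
  grothendieck (totalDim n r) (aRev n r) (bSeq n r) (zel n (maxRank r))

/-- The double quiver polynomial `K_r(a; b) = 𝔊_{ẑ(r)}(ă; b) / 𝔊_{ẑ(e)}(ă; b)`, as a rational
function. -/
noncomputable def doubleQuiver (n : ℕ) (r : ℕ → ℕ → ℕ) : QRat :=
  ratioNum n r / ratioDen n r

/-! Numerator and denominator are both compared with the product of the factors 1 - y_p / x_q over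
one diagram: the union of the blocks with rows b^k and columns a^j for j ≥ k + 2.

Call a diagram with weakly decreasing column lengths λ_q < w(q) below the graph of w. At an ascent i
of w, column i + 1 can be lengthened to the length of column i, and the result is below the graph of
w s_i. Its product is symmetric in x_i and x_{i+1}, so it passes through the Demazure operator which
produces 𝔊_w from 𝔊_{w s_i}. By induction on the number of non-inversions, the product over λ
divides 𝔊_w (`IsBelowGraph.exists_eq_mul_boxProd`). The same induction shows that, for a box (p, q)
which can be added to λ, the quotient forgets the common value of x_q and y_p
(`IsBelowGraph.subst_mergeVar_eq`). The essential case is the Demazure operator applied to (1 - y_p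
/ x_i) H: at x_i = y_p it collapses to a conjugate of H, for which the claim is known at the box (p,
i + 1).

The empty southeast blocks of z(r) (`IsRankConditions.conjZel_apply_le`) put the block diagram below
the graph of ẑ(r), for all rank conditions. For the maximal ones, the factors W_ij together have at
most as many inversions as the diagram has boxes. Hence ẑ(e) is dominant with exactly this diagram,
and 𝔊_{ẑ(e)} is the product (`ratioDen_eq`). So K_r is the quotient above, and the box of b^i_1 and
a^{i+1}_1 can be added to the diagram. -/

/-! ### Laurent polynomials and substitutions of variables -/

namespace QLaurent

/-- A variable, as a Laurent polynomial. -/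
noncomputable def X (v : QVar) : QLaurent :=
  AddMonoidAlgebra.single (Finsupp.single v 1) 1

/-- The inverse of a variable, as a Laurent polynomial. -/
noncomputable def Xinv (v : QVar) : QLaurent :=
  AddMonoidAlgebra.single (Finsupp.single v (-1)) 1

theorem X_mul_Xinv (v : QVar) : X v * Xinv v = 1 := by
  rw [X, Xinv, AddMonoidAlgebra.single_mul_single, ← Finsupp.single_add]
  simp [AddMonoidAlgebra.one_def]

/-- The substitution of variables for variables. -/
noncomputable def subst (f : QVar → QVar) : QLaurent →+* QLaurent :=
  AddMonoidAlgebra.mapDomainRingHom ℤ (Finsupp.mapDomain.addMonoidHom f)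

theorem subst_single (f : QVar → QVar) (m : QVar →₀ ℤ) (c : ℤ) :
    subst f (AddMonoidAlgebra.single m c) = AddMonoidAlgebra.single (m.mapDomain f) c :=
  AddMonoidAlgebra.mapDomain_single

@[simp] theorem subst_X (f : QVar → QVar) (v : QVar) : subst f (X v) = X (f v) := by
  simp [X, subst_single, Finsupp.mapDomain_single]

@[simp] theorem subst_Xinv (f : QVar → QVar) (v : QVar) : subst f (Xinv v) = Xinv (f v) := by
  rw [Xinv, subst_single, Finsupp.mapDomain_single, Xinv]

/-- Ring homomorphisms from the Laurent polynomials are determined by the values on variables. -/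
theorem ringHom_ext_X {S : Type*} [CommRing S] {f g : QLaurent →+* S}
    (h : ∀ v, f (X v) = g (X v)) : f = g := by
  have hinv : ∀ v, f (Xinv v) = g (Xinv v) := fun v => by
    have h1 : f (X v) * f (Xinv v) = 1 := by rw [← map_mul, X_mul_Xinv, map_one]
    have h2 : f (X v) * g (Xinv v) = 1 := by rw [h, ← map_mul, X_mul_Xinv, map_one]
    calc f (Xinv v) = (f (X v) * g (Xinv v)) * f (Xinv v) := by rw [h2, one_mul]
      _ = (f (X v) * f (Xinv v)) * g (Xinv v) := by ring
      _ = g (Xinv v) := by rw [h1, one_mul]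
  refine AddMonoidAlgebra.ringHom_ext (fun c => ?_) (fun m => ?_)
  · have h1 : ∀ φ : QLaurent →+* S, φ (AddMonoidAlgebra.single 0 c) = (c : S) := fun φ => by
      rw [← map_intCast φ c]; rfl
    rw [h1, h1]
  · induction m using Finsupp.induction_linear with
    | zero => rw [← AddMonoidAlgebra.one_def, map_one, map_one]
    | add m m' hm hm' =>
      have : (AddMonoidAlgebra.single (m + m') 1 : QLaurent)
          = AddMonoidAlgebra.single m 1 * AddMonoidAlgebra.single m' 1 := by
        rw [AddMonoidAlgebra.single_mul_single, one_mul]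
      rw [this, map_mul, map_mul, hm, hm']
    | single v k =>
      obtain ⟨k, rfl | rfl⟩ := k.eq_nat_or_neg
      · have : (AddMonoidAlgebra.single (Finsupp.single v (k : ℤ)) 1 : QLaurent) = X v ^ k := by
          simp [X, AddMonoidAlgebra.single_pow]
        rw [this, map_pow, map_pow, h]
      · have : (AddMonoidAlgebra.single (Finsupp.single v (-(k : ℤ))) 1 : QLaurent)
            = Xinv v ^ k := by
          simp [Xinv, AddMonoidAlgebra.single_pow]
        rw [this, map_pow, map_pow, hinv]

theorem subst_subst (f g : QVar → QVar) (P : QLaurent) :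
    subst f (subst g P) = subst (f ∘ g) P := by
  rw [← RingHom.comp_apply]
  exact RingHom.congr_fun (ringHom_ext_X fun v => by simp) P

theorem setVar_eq_subst (u v : QVar) : setVar u v = subst fun t => if t = u then v else t := rfl

/-- Every exponent vector of a substituted polynomial is pushed forward along the map of variables,
and `u` is not in the range of that map. -/
theorem independentOf_of_subst_eq {P : QLaurent} {u v : QVar} (huv : u ≠ v)
    (h : subst (fun t => if t = u then v else t) P = P) : P.IndependentOf u := by
  classical
  intro m hm
  rw [← h] at hm
  have hc : (subst (fun t => if t = u then v else t) P).coeff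
      = Finsupp.mapDomain (Finsupp.mapDomain fun t => if t = u then v else t) P.coeff := rfl
  rw [hc] at hm
  obtain ⟨m', -, rfl⟩ := Finset.mem_image.mp (Finsupp.mapDomain_support hm)
  refine Finsupp.mapDomain_of_notMem_range _ _ ?_
  rintro ⟨t, ht⟩
  by_cases h1 : t = u
  · simp only [h1, if_true] at ht; exact huv ht.symm
  · simp only [h1, if_false] at ht

theorem qMonomial_ofAdd (m : QVar →₀ ℤ) :
    qMonomial (Multiplicative.ofAdd m) = m.prod fun v k => qX v ^ k := rfl

theorem toRat_apply (P : QLaurent) :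
    toRat P = ∑ m ∈ P.coeff.support, (P.coeff m : QRat) * qMonomial (Multiplicative.ofAdd m) := by
  rw [toRat, AddMonoidAlgebra.lift_apply', Finsupp.sum]
  simp only [eq_intCast]

theorem toRat_single (m : QVar →₀ ℤ) :
    toRat (AddMonoidAlgebra.single m 1) = qMonomial (Multiplicative.ofAdd m) :=
  AddMonoidAlgebra.lift_of' _ _

@[simp] theorem toRat_X (v : QVar) : toRat (X v) = qX v := by
  rw [X, toRat_single, qMonomial_ofAdd, Finsupp.prod_single_index (zpow_zero _), zpow_one]

@[simp] theorem toRat_Xinv (v : QVar) : toRat (Xinv v) = (qX v)⁻¹ := by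
  rw [Xinv, toRat_single, qMonomial_ofAdd, Finsupp.prod_single_index (zpow_zero _), zpow_neg_one]

theorem qMonomial_natCast (m : QVar →₀ ℕ) :
    qMonomial (Multiplicative.ofAdd (m.mapRange (fun k : ℕ => (k : ℤ)) rfl))
      = algebraMap (MvPolynomial QVar ℤ) QRat (MvPolynomial.monomial m 1) := by
  rw [MvPolynomial.monomial_eq, MvPolynomial.C_1, one_mul]
  rw [qMonomial_ofAdd, Finsupp.prod_mapRange_index (fun v => zpow_zero _), Finsupp.prod, Finsupp.prod, map_prod]
  refine Finset.prod_congr rfl fun v _ => ?_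
  rw [zpow_natCast, map_pow]; rfl

theorem toRat_injective : Function.Injective toRat := by
  classical
  rw [injective_iff_map_eq_zero]
  intro P hP
  -- Denominators are cleared with the monomial `d`, the sum of the negative parts of all exponent
  -- vectors of `P`; `φ m` is then `m + d` with natural exponents.
  set d : QVar →₀ ℕ := ∑ m ∈ P.coeff.support, m.mapRange (fun k => (-k).toNat) (by simp) with hd
  set φ : (QVar →₀ ℤ) → (QVar →₀ ℕ) := fun m =>
    (m + d.mapRange (fun k : ℕ => (k : ℤ)) rfl).mapRange Int.toNat rfl with hφ
  have hpos : ∀ m ∈ P.coeff.support, (φ m).mapRange (fun k : ℕ => (k : ℤ)) rfl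
      = m + d.mapRange (fun k : ℕ => (k : ℤ)) rfl := by
    intro m hm
    ext v
    simp only [hφ, Finsupp.mapRange_apply, Finsupp.add_apply]
    have h1 : (-(m v)).toNat ≤ d v := by
      rw [hd, Finsupp.finsetSum_apply]
      exact Finset.single_le_sum (f := fun m : QVar →₀ ℤ =>
        (m.mapRange (fun k => (-k).toNat) (by simp) : QVar →₀ ℕ) v)
        (fun _ _ => Nat.zero_le _) hm
    omega
  have hsum : (∑ m ∈ P.coeff.support, MvPolynomial.monomial (φ m) (P.coeff m)) = 0 := by
    apply IsFractionRing.injective (MvPolynomial QVar ℤ) QRat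
    rw [map_zero, map_sum]
    have h0 : toRat P * qMonomial (Multiplicative.ofAdd (d.mapRange (fun k : ℕ => (k : ℤ)) rfl))
        = 0 := by rw [hP, zero_mul]
    rw [toRat_apply, Finset.sum_mul] at h0
    rw [← h0]
    refine Finset.sum_congr rfl fun m hm => ?_
    rw [mul_assoc, ← map_mul, ← ofAdd_add, ← hpos m hm, qMonomial_natCast,
      ← mul_one (P.coeff m), ← MvPolynomial.C_mul_monomial, map_mul]
    simp
  by_contra hne
  obtain ⟨m, hm⟩ : ∃ m, m ∈ P.coeff.support := by
    by_contra! h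
    exact hne (AddMonoidAlgebra.coeff_inj.mp (Finsupp.support_eq_empty.mp
      (Finset.eq_empty_of_forall_notMem h)))
  have hc := congrArg (MvPolynomial.coeff (φ m)) hsum
  rw [MvPolynomial.coeff_sum, Finset.sum_eq_single_of_mem m hm, MvPolynomial.coeff_monomial,
    if_pos rfl, MvPolynomial.coeff_zero] at hc
  · exact (Finsupp.mem_support_iff.mp hm) hc
  · intro m' hm' hne'
    rw [MvPolynomial.coeff_monomial, if_neg]
    intro h
    apply hne'
    have := hpos m' hm'
    rw [h, hpos m hm] at this
    exact (add_right_cancel this).symm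

instance : IsDomain QLaurent := toRat_injective.isDomain toRat.toRingHom

theorem X_injective : Function.Injective X := by
  intro u v h
  have h' := congrArg toRat h
  rw [toRat_X, toRat_X] at h'
  exact MvPolynomial.X_injective (IsFractionRing.injective (MvPolynomial QVar ℤ) QRat h')

theorem X_sub_X_ne_zero {u v : QVar} (h : u ≠ v) : X u - X v ≠ 0 :=
  sub_ne_zero.mpr fun h' => h (X_injective h')

/-! ### Exchange of two variables and Demazure operators -/

theorem qSwap_qX (u v t : QVar) : qSwap u v (qX t) = qX (Equiv.swap u v t) := by
  rw [qX, qSwap, IsFractionRing.ringEquivOfRingEquiv_algebraMap]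
  simp [qX]

theorem qSwap_toRat (u v : QVar) (P : QLaurent) :
    qSwap u v (toRat P) = toRat (subst (Equiv.swap u v) P) := by
  have : (qSwap u v : QRat →+* QRat).comp (toRat : QLaurent →+* QRat)
      = (toRat : QLaurent →+* QRat).comp (subst (Equiv.swap u v)) :=
    ringHom_ext_X fun t => by simp [qSwap_qX]
  exact RingHom.congr_fun this P

/-- Modulo X u - X v the interchange of the two variables is the identity, so `P` minus its image is
divisible by X u - X v. This keeps the whole recursion inside the Laurent polynomials. -/
theorem exists_demazure (u v : QVar) (P : QLaurent) :
    ∃ Q, (X u - X v) * Q = X u * P - X v * subst (Equiv.swap u v) P := by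
  let π := Ideal.Quotient.mk (Ideal.span {X u - X v})
  have hπ : π (X u) = π (X v) := by
    rw [← sub_eq_zero, ← map_sub]
    exact Ideal.Quotient.eq_zero_iff_mem.mpr (Ideal.subset_span rfl)
  have h : π = π.comp (subst (Equiv.swap u v)) := ringHom_ext_X fun t => by
    rw [RingHom.comp_apply, subst_X, Equiv.swap_apply_def]
    split_ifs with h1 h2
    · rw [h1, hπ]
    · rw [h2, hπ]
    · rfl
  have h1 : P - subst (Equiv.swap u v) P ∈ Ideal.span {X u - X v} := by
    rw [← Ideal.Quotient.eq_zero_iff_mem, map_sub, sub_eq_zero]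
    exact RingHom.congr_fun h P
  obtain ⟨R, hR⟩ := Ideal.mem_span_singleton'.mp h1
  exact ⟨P + X v * R, by linear_combination X v * hR⟩

/-- The Demazure operator (isobaric divided difference) of two variables. -/
noncomputable def demazure (u v : QVar) (P : QLaurent) : QLaurent := (exists_demazure u v P).choose

theorem demazure_spec (u v : QVar) (P : QLaurent) :
    (X u - X v) * demazure u v P = X u * P - X v * subst (Equiv.swap u v) P :=
  (exists_demazure u v P).choose_spec

theorem demazure_mul_of_symm {u v : QVar} (huv : u ≠ v) (P S : QLaurent)
    (hS : subst (Equiv.swap u v) S = S) : demazure u v (P * S) = demazure u v P * S := by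
  apply mul_left_cancel₀ (X_sub_X_ne_zero huv)
  rw [← mul_assoc, demazure_spec, demazure_spec, map_mul, hS]
  ring

theorem toRat_demazure {u v : QVar} (huv : u ≠ v) (P : QLaurent) :
    toRat (demazure u v P)
      = (qX u * toRat P - qX v * qSwap u v (toRat P)) / (qX u - qX v) := by
  have h : qX u - qX v ≠ 0 := by
    rw [← toRat_X, ← toRat_X, ← map_sub, ← map_zero toRat]
    exact fun h => X_sub_X_ne_zero huv (toRat_injective h)
  rw [eq_div_iff h, qSwap_toRat, ← toRat_X, ← toRat_X, ← map_mul, ← map_mul, ← map_sub,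
    ← map_sub, ← map_mul, ← demazure_spec, mul_comm]

/-- A substitution which does not involve the two variables commutes with the Demazure operator. -/
theorem subst_demazure {u v : QVar} (huv : u ≠ v) (f : QVar → QVar) (hu : f u = u) (hv : f v = v)
    (hf : ∀ t, f t = u ∨ f t = v → t = u ∨ t = v) (P : QLaurent) :
    subst f (demazure u v P) = demazure u v (subst f P) := by
  apply mul_left_cancel₀ (X_sub_X_ne_zero huv)
  have h := congrArg (subst f) (demazure_spec u v P)
  simp only [map_mul, map_sub, subst_X, hu, hv, subst_subst] at h
  rw [demazure_spec, h, subst_subst]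
  congr 3
  congr 1
  funext t
  simp only [Function.comp, Equiv.swap_apply_def]
  grind

end QLaurent

/-! ### Products over diagrams and the recursion for Grothendieck polynomials -/

open QLaurent

/-- The variables `x_1, …, x_N, y_1, …, y_N` are distinct. -/
structure DistinctVars (N : ℕ) (x y : ℕ → QVar) : Prop where
  injOn_left : Set.InjOn x (Set.Icc 1 N)
  injOn_right : Set.InjOn y (Set.Icc 1 N)
  ne : ∀ q p, q ∈ Set.Icc 1 N → p ∈ Set.Icc 1 N → x q ≠ y p

/-- The Laurent polynomial `1 - y_p / x_q`. -/
noncomputable def boxFactor (x y : ℕ → QVar) (p q : ℕ) : QLaurent := 1 - X (y p) * Xinv (x q)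

/-- The product of the factors `1 - y_p / x_q` over the diagram with column lengths `lam`. -/
noncomputable def boxProd (N : ℕ) (x y : ℕ → QVar) (lam : ℕ → ℕ) : QLaurent :=
  ∏ q ∈ Finset.Icc 1 N, ∏ p ∈ Finset.Icc 1 (lam q), boxFactor x y p q

section
variable {N : ℕ} {x y : ℕ → QVar}

theorem subst_boxFactor_of_fixed {f : QVar → QVar} {p q : ℕ} (hx : f (x q) = x q)
    (hy : f (y p) = y p) : subst f (boxFactor x y p q) = boxFactor x y p q := by
  simp [boxFactor, hx, hy]

theorem X_mul_boxFactor (p q : ℕ) : X (x q) * boxFactor x y p q = X (x q) - X (y p) := by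
  have := X_mul_Xinv (x q)
  rw [boxFactor]
  linear_combination (-X (y p)) * this

theorem boxFactor_ne_zero {p q : ℕ} (h : x q ≠ y p) : boxFactor x y p q ≠ 0 := fun h0 =>
  X_sub_X_ne_zero h (by rw [← X_mul_boxFactor, h0, mul_zero])

theorem boxProd_congr {lam mu : ℕ → ℕ} (h : ∀ q ∈ Set.Icc 1 N, lam q = mu q) :
    boxProd N x y lam = boxProd N x y mu :=
  Finset.prod_congr rfl fun q hq => by rw [h q (by simpa using hq)]

theorem boxProd_ne_zero (hd : DistinctVars N x y) {lam : ℕ → ℕ}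
    (h : ∀ q ∈ Set.Icc 1 N, lam q ≤ N) : boxProd N x y lam ≠ 0 := by
  refine Finset.prod_ne_zero_iff.mpr fun q hq => Finset.prod_ne_zero_iff.mpr fun p hp => ?_
  simp only [Finset.mem_Icc] at hq hp
  exact boxFactor_ne_zero (hd.ne q p hq ⟨hp.1, hp.2.trans (h q hq)⟩)

theorem boxProd_mul_of_le {lam mu : ℕ → ℕ} (h : ∀ q ∈ Set.Icc 1 N, lam q ≤ mu q) :
    boxProd N x y mu = (∏ q ∈ Finset.Icc 1 N, ∏ p ∈ Finset.Ioc (lam q) (mu q),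
      boxFactor x y p q) * boxProd N x y lam := by
  rw [boxProd, boxProd, ← Finset.prod_mul_distrib]
  refine Finset.prod_congr rfl fun q hq => ?_
  have := h q (by simpa using hq)
  rw [mul_comm, ← Finset.prod_union]
  · congr 1; ext p; simp only [Finset.mem_union, Finset.mem_Icc, Finset.mem_Ioc]; omega
  · refine Finset.disjoint_left.mpr fun p hp => ?_
    simp only [Finset.mem_Icc, Finset.mem_Ioc] at hp ⊢; omega

theorem boxProd_update {lam : ℕ → ℕ} {q k : ℕ} (hq : q ∈ Set.Icc 1 N) (hk : lam q ≤ k) :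
    boxProd N x y (Function.update lam q k)
      = (∏ p ∈ Finset.Ioc (lam q) k, boxFactor x y p q) * boxProd N x y lam := by
  rw [boxProd_mul_of_le (lam := lam), Finset.prod_eq_single q]
  · simp
  · intro q' _ hne; simp [Function.update_of_ne hne]
  · intro h; exact absurd (by simpa using hq) h
  · intro q' _
    by_cases h : q' = q
    · subst h; simpa using hk
    · simp [Function.update_of_ne h]

theorem boxProd_update_succ {lam : ℕ → ℕ} {q : ℕ} (hq : q ∈ Set.Icc 1 N) :
    boxProd N x y (Function.update lam q (lam q + 1))
      = boxFactor x y (lam q + 1) q * boxProd N x y lam := by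
  rw [boxProd_update hq (Nat.le_succ _)]
  simp

theorem swap_apply_of_injOn (hd : DistinctVars N x y) {i q : ℕ} (hi : i ∈ Set.Ico 1 N)
    (hq : q ∈ Set.Icc 1 N) :
    Equiv.swap (x i) (x (i + 1)) (x q) = x (Equiv.swap i (i + 1) q) := by
  have h1 : x q = x i ↔ q = i := hd.injOn_left.eq_iff hq ⟨hi.1, hi.2.le⟩
  have h2 : x q = x (i + 1) ↔ q = i + 1 := hd.injOn_left.eq_iff hq ⟨Nat.le_add_left _ _, hi.2⟩
  simp only [Equiv.swap_apply_def, h1, h2]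
  split_ifs <;> rfl

theorem swap_apply_right (hd : DistinctVars N x y) {i p : ℕ} (hi : i ∈ Set.Ico 1 N)
    (hp : p ∈ Set.Icc 1 N) : Equiv.swap (x i) (x (i + 1)) (y p) = y p :=
  Equiv.swap_apply_of_ne_of_ne (hd.ne i p ⟨hi.1, hi.2.le⟩ hp).symm
    (hd.ne (i + 1) p ⟨Nat.le_add_left _ _, hi.2⟩ hp).symm

theorem swap_mem_Icc {i q : ℕ} (hi : i ∈ Set.Ico 1 N) :
    Equiv.swap i (i + 1) q ∈ Set.Icc 1 N ↔ q ∈ Set.Icc 1 N := by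
  simp only [Set.mem_Ico, Set.mem_Icc, Equiv.swap_apply_def] at hi ⊢
  split_ifs <;> omega

/-- The product over a diagram is symmetric in the variables of two columns of the same length. -/
theorem subst_swap_boxProd (hd : DistinctVars N x y) {lam : ℕ → ℕ}
    (hN : ∀ q ∈ Set.Icc 1 N, lam q ≤ N) {i : ℕ} (hi : i ∈ Set.Ico 1 N)
    (h : lam (i + 1) = lam i) :
    subst (Equiv.swap (x i) (x (i + 1))) (boxProd N x y lam) = boxProd N x y lam := by
  rw [boxProd, map_prod]
  refine Finset.prod_bij' (fun q _ => Equiv.swap i (i + 1) q) (fun q _ => Equiv.swap i (i + 1) q)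
    (fun q hq => ?_) (fun q hq => ?_) (fun q _ => by simp) (fun q _ => by simp) fun q hq => ?_
  · simpa using (swap_mem_Icc hi).mpr (by simpa using hq)
  · simpa using (swap_mem_Icc hi).mpr (by simpa using hq)
  · have hl : lam (Equiv.swap i (i + 1) q) = lam q := by
      rw [Equiv.swap_apply_def]; split_ifs with h1 h2
      · rw [h1, h]
      · rw [h2, h]
      · rfl
    have hq' : q ∈ Set.Icc 1 N := by simpa using hq
    rw [map_prod, hl]
    refine Finset.prod_congr rfl fun p hp => ?_
    have hp' : p ∈ Set.Icc 1 N := by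
      simp only [Finset.mem_Icc] at hp; exact ⟨hp.1, hp.2.trans (hN q hq')⟩
    simp [boxFactor, swap_apply_of_injOn hd hi hq', swap_apply_right hd hi hp']

/-- The minimality of the ascent is recorded because the treatment of dominant permutations needs
descents at all earlier positions. -/
theorem exists_grothendieck_eq {w : Equiv.Perm ℕ} (h : (ascents N w).Nonempty) :
    ∃ i ∈ Set.Ico 1 N, w i < w (i + 1) ∧ (∀ j, 1 ≤ j → j < i → w (j + 1) < w j) ∧
      nonInv N (w * Equiv.swap i (i + 1)) < nonInv N w ∧
      grothendieck N x y w = (qX (x i) * grothendieck N x y (w * Equiv.swap i (i + 1))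
        - qX (x (i + 1)) *
          qSwap (x i) (x (i + 1)) (grothendieck N x y (w * Equiv.swap i (i + 1))))
        / (qX (x i) - qX (x (i + 1))) := by
  have hm := (ascents N w).min'_mem h
  have hm' := hm
  simp only [ascents, Finset.mem_filter, Finset.mem_Ico] at hm'
  refine ⟨(ascents N w).min' h, hm'.1, hm'.2, fun j hj1 hj => ?_, nonInv_lt N _ w hm, ?_⟩
  · have hlt : ¬ w j < w (j + 1) := fun hlt => by
      have : j ∈ ascents N w := by
        simp only [ascents, Finset.mem_filter, Finset.mem_Ico]
        exact ⟨⟨hj1, hj.trans hm'.1.2⟩, hlt⟩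
      exact absurd ((ascents N w).min'_le j this) (not_le.mpr hj)
    have : w (j + 1) ≠ w j := fun h => by simpa using w.injective h
    omega
  · rw [grothendieck, dif_pos h]

/-- The values decrease strictly; counting from position 1 bounds them above and counting back from
position N bounds them below. -/
theorem apply_eq_of_ascents_empty {w : Equiv.Perm ℕ}
    (hw : Set.MapsTo w (Set.Icc 1 N) (Set.Icc 1 N)) (h : ¬ (ascents N w).Nonempty) {q : ℕ}
    (hq : q ∈ Set.Icc 1 N) : w q = N + 1 - q := by
  have hdesc : ∀ i, 1 ≤ i → i < N → w (i + 1) < w i := fun i h1 h2 => by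
    have hlt : ¬ w i < w (i + 1) := fun hlt => h ⟨i, by
      simp only [ascents, Finset.mem_filter, Finset.mem_Ico]; exact ⟨⟨h1, h2⟩, hlt⟩⟩
    have : w (i + 1) ≠ w i := fun h => by simpa using w.injective h
    omega
  have hup : ∀ k, 1 ≤ k → k ≤ N → w k + k ≤ N + 1 := fun k hk => by
    induction k, hk using Nat.le_induction with
    | base => intro h1; have := hw ⟨le_refl 1, h1⟩; simp only [Set.mem_Icc] at this; omega
    | succ k hk ih =>
      intro h1
      have := hdesc k hk h1
      have := ih (by omega)
      omega
  have hdown : ∀ k, k < N → N + 1 ≤ w (N - k) + (N - k) := fun k => by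
    induction k with
    | zero => intro h1; have := hw ⟨h1, le_refl N⟩; simp only [Set.mem_Icc, Nat.sub_zero] at this ⊢; omega
    | succ k ih =>
      intro h1
      have h2 := hdesc (N - (k + 1)) (by omega) (by omega)
      rw [show N - (k + 1) + 1 = N - k by omega] at h2
      have := ih (by omega)
      omega
  have h1 := hup q hq.1 hq.2
  have h2 := hdown (N - q) (by have := hq.1; have := hq.2; omega)
  rw [Nat.sub_sub_self hq.2] at h2
  omega

theorem grothendieck_of_ascents_empty {w : Equiv.Perm ℕ} (h : ¬ (ascents N w).Nonempty) :
    grothendieck N x y w = toRat (boxProd N x y fun q => N - q) := by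
  rw [grothendieck, dif_neg h, boxProd, map_prod, Finset.prod_filter, Finset.prod_product_right]
  refine Finset.prod_congr rfl fun q hq => ?_
  rw [map_prod, ← Finset.prod_filter]
  refine Finset.prod_congr ?_ fun p _ => by simp [boxFactor, div_eq_mul_inv]
  ext p
  simp only [Finset.mem_filter, Finset.mem_Icc] at hq ⊢
  omega

/-- If the polynomial of `w s_i` is divisible by a product symmetric in `x_i` and `x_{i+1}`, then so
is the polynomial of `w`. -/
theorem toRat_demazure_mul_boxProd (hd : DistinctVars N x y) {lam : ℕ → ℕ}
    (hN : ∀ q ∈ Set.Icc 1 N, lam q ≤ N) {i : ℕ} (hi : i ∈ Set.Ico 1 N) (h : lam (i + 1) = lam i)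
    {F : QLaurent} {g : QRat} (hF : toRat (F * boxProd N x y lam) = g) :
    (qX (x i) * g - qX (x (i + 1)) * qSwap (x i) (x (i + 1)) g) / (qX (x i) - qX (x (i + 1)))
      = toRat (demazure (x i) (x (i + 1)) F * boxProd N x y lam) := by
  have hne : x i ≠ x (i + 1) := fun h => by
    simpa using hd.injOn_left ⟨hi.1, hi.2.le⟩ ⟨Nat.le_add_left _ _, hi.2⟩ h
  rw [← demazure_mul_of_symm hne _ _ (subst_swap_boxProd hd hN hi h), toRat_demazure hne, hF]

/-! ### Diagrams below the graph: divisibility and independence -/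

theorem mapsTo_mul_swap {w : Equiv.Perm ℕ} (hw : Set.MapsTo w (Set.Icc 1 N) (Set.Icc 1 N))
    {i : ℕ} (hi : i ∈ Set.Ico 1 N) :
    Set.MapsTo (w * Equiv.swap i (i + 1)) (Set.Icc 1 N) (Set.Icc 1 N) :=
  fun _ hq => hw ((swap_mem_Icc hi).mpr hq)

/-- The column lengths `lam` describe a diagram to the upper left of the graph of `w`. -/
structure IsBelowGraph (N : ℕ) (lam : ℕ → ℕ) (w : Equiv.Perm ℕ) : Prop where
  mapsTo : Set.MapsTo w (Set.Icc 1 N) (Set.Icc 1 N)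
  anti : ∀ q, 1 ≤ q → q < N → lam (q + 1) ≤ lam q
  lt : ∀ q, 1 ≤ q → q ≤ N → lam q < w q

namespace IsBelowGraph
variable {lam : ℕ → ℕ} {w : Equiv.Perm ℕ}

theorem le (h : IsBelowGraph N lam w) : ∀ q ∈ Set.Icc 1 N, lam q ≤ N := fun q hq =>
  (h.lt q hq.1 hq.2).le.trans (h.mapsTo hq).2

theorem antitoneOn (h : IsBelowGraph N lam w) {k l : ℕ} (hk : 1 ≤ k) (hkl : k ≤ l) (hl : l ≤ N) :
    lam l ≤ lam k := by
  induction l, hkl using Nat.le_induction with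
  | base => exact le_rfl
  | succ l hkl ih => exact (h.anti l (hk.trans hkl) hl).trans (ih (by omega))

/-- The new value at i + 1 is w(i), which exceeds `lam i`, so there is room to make columns i and i
+ 1 equally long. This equality is what makes the product symmetric. -/
theorem mul_swap (h : IsBelowGraph N lam w) {i : ℕ} (hi : i ∈ Set.Ico 1 N)
    (hlt : w i < w (i + 1)) :
    IsBelowGraph N (Function.update lam (i + 1) (lam i)) (w * Equiv.swap i (i + 1)) where
  mapsTo := mapsTo_mul_swap h.mapsTo hi
  anti q h1 h2 := by
    have := h.anti q h1 h2
    have := h.anti i hi.1 hi.2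
    simp only [Function.update_apply]
    grind
  lt q h1 h2 := by
    have := h.lt q h1 h2
    have := h.lt i hi.1 hi.2.le
    have := h.anti i hi.1 hi.2
    simp only [Function.update_apply, Equiv.Perm.mul_apply, Equiv.swap_apply_def]
    grind

theorem update_succ (h : IsBelowGraph N lam w) {q : ℕ} (hq : lam q + 1 < w q)
    (hc : q = 1 ∨ lam q < lam (q - 1)) :
    IsBelowGraph N (Function.update lam q (lam q + 1)) w where
  mapsTo := h.mapsTo
  anti p h1 h2 := by
    have := h.anti p h1 h2
    simp only [Function.update_apply]
    grind
  lt p h1 h2 := by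
    have := h.lt p h1 h2
    simp only [Function.update_apply]
    grind

/-- A double Grothendieck polynomial is divisible by the factors in the dominant part of its
diagram. -/
theorem exists_eq_mul_boxProd (hd : DistinctVars N x y) (h : IsBelowGraph N lam w) :
    ∃ F, toRat (F * boxProd N x y lam) = grothendieck N x y w := by
  induction hm : nonInv N w using Nat.strong_induction_on generalizing w lam with
  | _ m ih =>
  by_cases ha : (ascents N w).Nonempty
  · obtain ⟨i, hi, hlt, -, hlt', hG⟩ := exists_grothendieck_eq (x := x) (y := y) ha
    have h' := h.mul_swap hi hlt
    obtain ⟨F, hF⟩ := ih _ (hm ▸ hlt') h' rfl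
    rw [hG, toRat_demazure_mul_boxProd hd h'.le hi (by simp) hF,
      boxProd_update ⟨Nat.le_add_left _ _, hi.2⟩ (h.anti i hi.1 hi.2), ← mul_assoc]
    exact ⟨_, rfl⟩
  · rw [grothendieck_of_ascents_empty ha,
      boxProd_mul_of_le (lam := lam) (mu := fun q => N - q)]
    · exact ⟨_, rfl⟩
    · intro q hq
      have h1 := h.lt q hq.1 hq.2
      rw [apply_eq_of_ascents_empty h.mapsTo ha hq] at h1
      omega

end IsBelowGraph

/-- The substitution of `v` for both `u` and `u'`. -/
def mergeVar (u u' v : QVar) (t : QVar) : QVar := if t = u ∨ t = u' then v else t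

namespace IsBelowGraph
variable {lam : ℕ → ℕ} {w : Equiv.Perm ℕ}

/-- After division by the factors in the diagram `lam`, a double Grothendieck polynomial does not
depend on the common value of `x_q` and `y_p` if `(p, q)` can be added to the diagram. -/
theorem subst_mergeVar_eq (hd : DistinctVars N x y) (h : IsBelowGraph N lam w) {F : QLaurent}
    (hF : toRat (F * boxProd N x y lam) = grothendieck N x y w) {q : ℕ} (hq : q ∈ Set.Icc 1 N)
    (hc : q = 1 ∨ lam q < lam (q - 1)) {v v' : QVar} (hv : ∀ i ∈ Set.Icc 1 N, v ≠ x i)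
    (hv' : ∀ i ∈ Set.Icc 1 N, v' ≠ x i) :
    subst (mergeVar (x q) (y (lam q + 1)) v) F = subst (mergeVar (x q) (y (lam q + 1)) v') F := by
  induction hm : nonInv N w using Nat.strong_induction_on generalizing w lam F q with
  | _ m ih =>
  have hlamq := h.lt q hq.1 hq.2
  have hwq := (h.mapsTo hq).2
  have hp : lam q + 1 ∈ Set.Icc 1 N := ⟨Nat.le_add_left _ _, by omega⟩
  have hE := boxProd_ne_zero hd h.le
  have hxfix : ∀ v, ∀ q' ∈ Set.Icc 1 N, q' ≠ q →
      mergeVar (x q) (y (lam q + 1)) v (x q') = x q' := fun v q' h1 h2 =>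
    if_neg (by
      rintro (h3 | h3)
      · exact h2 (hd.injOn_left h1 hq h3)
      · exact hd.ne _ _ h1 hp h3)
  have hyfix : ∀ v, ∀ p' ∈ Set.Icc 1 N, p' ≠ lam q + 1 →
      mergeVar (x q) (y (lam q + 1)) v (y p') = y p' := fun v p' h1 h2 =>
    if_neg (by
      rintro (h3 | h3)
      · exact hd.ne _ _ hq h1 h3.symm
      · exact h2 (hd.injOn_right h1 hp h3))
  have hx : ∀ v, mergeVar (x q) (y (lam q + 1)) v (x q) = v := fun v => if_pos (Or.inl rfl)
  have hy : ∀ v, mergeVar (x q) (y (lam q + 1)) v (y (lam q + 1)) = v :=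
    fun v => if_pos (Or.inr rfl)
  -- If the diagram with the box added is still below the graph, then F is divisible by 1 - y_p /
  -- x_q and both substitutions give 0. What remains is the case `lam q + 1 = w q`.
  rcases (Nat.succ_le_of_lt hlamq).lt_or_eq with hlt | heq
  · obtain ⟨F', hF'⟩ := (h.update_succ hlt hc).exists_eq_mul_boxProd hd
    rw [← hF, boxProd_update_succ hq, ← mul_assoc] at hF'
    have hFF : F' * boxFactor x y (lam q + 1) q = F := mul_right_cancel₀ hE (toRat_injective hF')
    have hz : ∀ v, subst (mergeVar (x q) (y (lam q + 1)) v) F = 0 := fun v => by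
      rw [← hFF, map_mul, boxFactor, map_sub, map_mul, map_one, subst_X, subst_Xinv, hx, hy,
        X_mul_Xinv, sub_self, mul_zero]
    rw [hz, hz]
  by_cases ha : (ascents N w).Nonempty
  · obtain ⟨i, hi, hlt, -, hlt', hG⟩ := exists_grothendieck_eq (x := x) (y := y) ha
    have hi0 : i ∈ Set.Icc 1 N := ⟨hi.1, hi.2.le⟩
    have hi1 : i + 1 ∈ Set.Icc 1 N := ⟨Nat.le_add_left _ _, hi.2⟩
    have hanti := h.anti i hi.1 hi.2
    have hilt := h.lt i hi.1 hi.2.le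
    have hne : x i ≠ x (i + 1) := fun h => by simpa using hd.injOn_left hi0 hi1 h
    have h' := h.mul_swap hi hlt
    -- For q = i + 1, the chain lam i < w i < w (i + 1) = lam (i + 1) + 1 contradicts the corner
    -- condition lam (i + 1) < lam i.
    have hq1 : i + 1 ≠ q := by
      rintro rfl
      rcases hc with hc | hc
      · have := hi.1; omega
      · rw [Nat.add_sub_cancel] at hc; omega
    -- The factors added in column i + 1 avoid row lam q + 1: they end above it if q ≤ i, and start
    -- below it if i + 1 < q.
    have hR : ∀ v, subst (mergeVar (x q) (y (lam q + 1)) v)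
        (∏ p ∈ Finset.Ioc (lam (i + 1)) (lam i), boxFactor x y p (i + 1))
        = ∏ p ∈ Finset.Ioc (lam (i + 1)) (lam i), boxFactor x y p (i + 1) := fun v => by
      rw [map_prod]
      refine Finset.prod_congr rfl fun p hp' => ?_
      rw [Finset.mem_Ioc] at hp'
      have hpN := h.le i hi0
      refine subst_boxFactor_of_fixed (hxfix v _ hi1 hq1)
        (hyfix v p ⟨by omega, by omega⟩ ?_)
      rintro rfl
      have hmono := fun k l => h.antitoneOn (k := k) (l := l)
      rcases lt_or_ge i q with hiq | hiq
      · rcases hc with hc | hc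
        · have := hi.1; omega
        · have := hmono (i + 1) (q - 1) (by omega) (by omega) (by have := hq.2; omega)
          omega
      · have := hmono q i hq.1 hiq hi.2.le
        omega
    -- For i = q, the value of w s_i at i is w (i + 1) > lam i + 1, so the box in column i can be
    -- added for w s_i. The box to its right in column i + 1 then becomes addable, and the induction
    -- hypothesis is used there for the quotient H.
    by_cases hiq : i = q
    · subst hiq
      have hl : (Function.update lam (i + 1) (lam i)) i = lam i :=
        Function.update_of_ne (by omega) _ _
      have h'' : IsBelowGraph N (Function.update (Function.update lam (i + 1) (lam i)) i
          (lam i + 1)) (w * Equiv.swap i (i + 1)) := by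
        have := h'.update_succ (q := i) (by
          rw [hl, Equiv.Perm.mul_apply, Equiv.swap_apply_left]; omega)
          (hc.imp_right fun hc => by
            rwa [hl, Function.update_of_ne (by omega)])
        rwa [hl] at this
      obtain ⟨H, hH⟩ := h''.exists_eq_mul_boxProd hd
      have hl1 : (Function.update (Function.update lam (i + 1) (lam i)) i
          (lam i + 1)) (i + 1) = lam i := by
        rw [Function.update_of_ne (by omega), Function.update_self]
      have hIH := ih _ (hm ▸ hlt') h'' hH hi1 (Or.inr (by
        rw [hl1, Nat.add_sub_cancel, Function.update_self]; omega)) rfl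
      rw [hl1] at hIH
      have hu := boxProd_update_succ (x := x) (y := y)
        (lam := Function.update lam (i + 1) (lam i)) hi0
      rw [hl] at hu
      rw [hu, ← mul_assoc] at hH
      rw [hG, toRat_demazure_mul_boxProd hd h'.le hi (by simp) hH,
        boxProd_update hi1 hanti, ← mul_assoc] at hF
      have hFF := mul_right_cancel₀ hE (toRat_injective hF)
      have hyi : Equiv.swap (x i) (x (i + 1)) (y (lam i + 1)) = y (lam i + 1) :=
        swap_apply_right hd hi hp
      have key : ∀ v, (∀ i ∈ Set.Icc 1 N, v ≠ x i) →
          subst (mergeVar (x i) (y (lam i + 1)) v)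
            (demazure (x i) (x (i + 1)) (H * boxFactor x y (lam i + 1) i))
          = subst (Equiv.swap (x i) (x (i + 1)))
            (subst (mergeVar (x (i + 1)) (y (lam i + 1)) v) H) := by
        intro v hv
        have hD := demazure_spec (x i) (x (i + 1)) (H * boxFactor x y (lam i + 1) i)
        have hb : X (x (i + 1)) * subst (Equiv.swap (x i) (x (i + 1)))
            (boxFactor x y (lam i + 1) i) = X (x (i + 1)) - X (y (lam i + 1)) := by
          rw [← X_mul_boxFactor]
          simp [boxFactor, hyi]
        -- At x_i = y_p = v the first term on the right vanishes and the factor v - x_{i+1} cancels.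
        -- What is left is s_i applied to H at x_{i+1} = y_p = v.
        have hD' : (X (x i) - X (x (i + 1))) *
            demazure (x i) (x (i + 1)) (H * boxFactor x y (lam i + 1) i)
            = (X (x i) - X (y (lam i + 1))) * H
              - (X (x (i + 1)) - X (y (lam i + 1))) * subst (Equiv.swap (x i) (x (i + 1))) H := by
          rw [hD, map_mul]
          linear_combination H * X_mul_boxFactor (x := x) (y := y) (lam i + 1) i
            - (subst (Equiv.swap (x i) (x (i + 1))) H) * hb
        have hD2 := congrArg (subst (mergeVar (x i) (y (lam i + 1)) v)) hD'
        simp only [map_mul, map_sub, subst_X, hx, hy, hxfix v (i + 1) hi1 hq1, sub_self, zero_mul,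
          zero_sub] at hD2
        apply mul_left_cancel₀ (X_sub_X_ne_zero (hv _ hi1))
        rw [hD2, subst_subst, subst_subst, ← neg_mul, neg_sub]
        congr 3
        funext t
        have h1 := hv _ hi0
        have h2 := hv _ hi1
        have h3 := hd.ne _ _ hi0 hp
        have h4 := hd.ne _ _ hi1 hp
        simp only [Function.comp, mergeVar, Equiv.swap_apply_def]
        grind
      rw [hFF, map_mul, map_mul, hR, hR, key v hv, key v' hv', hIH]
    -- For i ≠ q the box stays addable for w s_i, and identifying x_q with y_p commutes with the
    -- Demazure operator in the other variables x_i and x_{i+1}.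
    · obtain ⟨F', hF'⟩ := h'.exists_eq_mul_boxProd hd
      have hl : ∀ k, k ≠ i + 1 → (Function.update lam (i + 1) (lam i)) k = lam k :=
        fun k hk => Function.update_of_ne hk _ _
      have hIH := ih _ (hm ▸ hlt') h' hF' hq (hc.imp_right fun hc => by
        rw [hl q (Ne.symm hq1)]
        by_cases hk : q - 1 = i + 1
        · rw [hk] at hc; rw [hk, Function.update_self]; omega
        · rwa [hl _ hk]) rfl
      rw [hl q (Ne.symm hq1)] at hIH
      rw [hG, toRat_demazure_mul_boxProd hd h'.le hi (by simp) hF',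
        boxProd_update hi1 hanti, ← mul_assoc] at hF
      have hFF := mul_right_cancel₀ hE (toRat_injective hF)
      have key : ∀ v, (∀ i ∈ Set.Icc 1 N, v ≠ x i) →
          subst (mergeVar (x q) (y (lam q + 1)) v) (demazure (x i) (x (i + 1)) F')
          = demazure (x i) (x (i + 1)) (subst (mergeVar (x q) (y (lam q + 1)) v) F') :=
        fun v hv => subst_demazure hne _ (hxfix v i hi0 hiq) (hxfix v _ hi1 hq1) (by
          have h1 := hv _ hi0
          have h2 := hv _ hi1
          intro t
          simp only [mergeVar]
          grind) F'
      rw [hFF, map_mul, map_mul, hR, hR, key v hv, key v' hv', hIH]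
  · rw [grothendieck_of_ascents_empty ha,
      boxProd_mul_of_le (lam := lam) (mu := fun q => N - q)] at hF
    · have hFF := mul_right_cancel₀ hE (toRat_injective hF)
      have hmono := fun k l => h.antitoneOn (k := k) (l := l)
      rw [apply_eq_of_ascents_empty h.mapsTo ha hq] at heq
      -- For the longest permutation F is the product over the staircase outside `lam`. Column q is
      -- already full, columns to its left contain row lam q + 1 in `lam`, and columns to its right
      -- end above that row; so neither variable occurs in F.
      have hfix : ∀ v, subst (mergeVar (x q) (y (lam q + 1)) v) F = F := fun v => by
        rw [hFF, map_prod]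
        refine Finset.prod_congr rfl fun q' hq' => ?_
        rw [map_prod]
        refine Finset.prod_congr rfl fun p' hp' => ?_
        rw [Finset.mem_Icc] at hq'
        rw [Finset.mem_Ioc] at hp'
        refine subst_boxFactor_of_fixed (hxfix v _ hq' ?_)
          (hyfix v p' ⟨by omega, by omega⟩ ?_)
        · rintro rfl; omega
        · rintro rfl
          rcases hc with hc | hc
          · omega
          · have := hmono q' (q - 1) (by omega) (by omega) (by have := hq.2; omega)
            omega
      rw [hfix, hfix]
    · intro q hq
      have h1 := h.lt q hq.1 hq.2
      rw [apply_eq_of_ascents_empty h.mapsTo ha hq] at h1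
      omega

end IsBelowGraph

/-! ### Dominant permutations -/

/-- The Lehmer code of `w` in `S_N`. -/
def lehmerCode (N : ℕ) (w : Equiv.Perm ℕ) (q : ℕ) : ℕ :=
  ((Finset.Ioc q N).filter fun q' => w q' < w q).card

theorem lehmerCode_le_of_lt {w : Equiv.Perm ℕ} {i : ℕ} (h : w i < w (i + 1)) :
    lehmerCode N w i ≤ lehmerCode N w (i + 1) := by
  refine Finset.card_le_card fun q' hq' => ?_
  simp only [Finset.mem_filter, Finset.mem_Ioc] at hq' ⊢
  have : q' ≠ i + 1 := by rintro rfl; omega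
  omega

theorem lehmerCode_lt_of_lt {w : Equiv.Perm ℕ} {i : ℕ} (hi : i < N) (h : w (i + 1) < w i) :
    lehmerCode N w (i + 1) < lehmerCode N w i := by
  refine Finset.card_lt_card (Finset.ssubset_iff_of_subset (fun q' hq' => ?_) |>.mpr
    ⟨i + 1, ?_, ?_⟩)
  all_goals simp only [Finset.mem_filter, Finset.mem_Ioc] at *
  all_goals omega

/-- After the swap, position i sees the smaller values that i + 1 saw, and in addition w(i) itself
at i + 1. Position i + 1 inherits the old code of i, which equals its own by assumption. -/
theorem lehmerCode_mul_swap {w : Equiv.Perm ℕ} {i : ℕ} (hi : i ∈ Set.Ico 1 N)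
    (h : w i < w (i + 1)) (hc : lehmerCode N w (i + 1) = lehmerCode N w i) (q : ℕ) :
    lehmerCode N (w * Equiv.swap i (i + 1)) q
      = Function.update (lehmerCode N w) i (lehmerCode N w i + 1) q := by
  have hN := hi.2
  rcases eq_or_ne q i with rfl | hqi
  · rw [Function.update_self, ← hc, lehmerCode, lehmerCode,
      ← Finset.card_insert_of_notMem (a := q + 1) (by simp)]
    congr 1
    ext q'
    simp only [Finset.mem_filter, Finset.mem_Ioc, Finset.mem_insert, Equiv.Perm.mul_apply,
      Equiv.swap_apply_def]
    grind
  · rw [Function.update_of_ne hqi]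
    rcases eq_or_ne q (i + 1) with rfl | hqi1
    · rw [hc, lehmerCode, lehmerCode]
      congr 1
      ext q'
      simp only [Finset.mem_filter, Finset.mem_Ioc, Equiv.Perm.mul_apply, Equiv.swap_apply_def]
      grind
    · refine Finset.card_nbij' (Equiv.swap i (i + 1)) (Equiv.swap i (i + 1)) ?_ ?_
        (fun _ _ => by simp) (fun _ _ => by simp)
      all_goals
        intro q'
        simp only [Finset.coe_filter, Finset.mem_Ioc, Set.mem_ofPred_eq, Equiv.Perm.mul_apply,
          Equiv.swap_apply_def]
        grind

/-- The double Grothendieck polynomial of a dominant permutation is a product. -/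
theorem grothendieck_of_lehmerCode_anti (hd : DistinctVars N x y) {w : Equiv.Perm ℕ}
    (hw : Set.MapsTo w (Set.Icc 1 N) (Set.Icc 1 N))
    (h : ∀ q, 1 ≤ q → q < N → lehmerCode N w (q + 1) ≤ lehmerCode N w q) :
    grothendieck N x y w = toRat (boxProd N x y (lehmerCode N w)) := by
  have hcN : ∀ (w : Equiv.Perm ℕ), ∀ q ∈ Set.Icc 1 N, lehmerCode N w q < N := fun w q hq => by
    refine lt_of_le_of_lt (Finset.card_filter_le _ _) ?_
    rw [Nat.card_Ioc]
    have := hq.1; have := hq.2; omega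
  induction hm : nonInv N w using Nat.strong_induction_on generalizing w with
  | _ m ih =>
  by_cases ha : (ascents N w).Nonempty
  · obtain ⟨i, hi, hlt, hmin, hlt', hG⟩ := exists_grothendieck_eq (x := x) (y := y) ha
    have hi0 : i ∈ Set.Icc 1 N := ⟨hi.1, hi.2.le⟩
    have hi1 : i + 1 ∈ Set.Icc 1 N := ⟨Nat.le_add_left _ _, hi.2⟩
    have hne : x i ≠ x (i + 1) := fun h => by simpa using hd.injOn_left hi0 hi1 h
    have hc := le_antisymm (h i hi.1 hi.2) (lehmerCode_le_of_lt hlt)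
    have hc' := lehmerCode_mul_swap hi hlt hc
    have hIH := ih _ (hm ▸ hlt') (mapsTo_mul_swap hw hi) (fun q h1 h2 => by
      have h3 := h q h1 h2
      -- All positions before the first ascent are descents, so the code drops strictly just before
      -- i, and column i can grow by a box without loss of dominance.
      have h4 : q + 1 = i → lehmerCode N w (q + 1) < lehmerCode N w q := fun h4 =>
        lehmerCode_lt_of_lt h2 (hmin q h1 (by omega))
      rw [hc', hc']
      simp only [Function.update_apply]
      grind) rfl
    rw [boxProd_congr fun q _ => hc' q, boxProd_update_succ hi0] at hIH
    rw [hG, toRat_demazure_mul_boxProd hd (fun q hq => (hcN w q hq).le) hi hc hIH.symm]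
    have h1 : demazure (x i) (x (i + 1)) (boxFactor x y (lehmerCode N w i + 1) i) = 1 := by
      apply mul_left_cancel₀ (X_sub_X_ne_zero hne)
      have hyi := swap_apply_right hd hi (p := lehmerCode N w i + 1)
        ⟨Nat.le_add_left _ _, hcN w i hi0⟩
      have h2 := X_mul_boxFactor (x := x) (y := y) (lehmerCode N w i + 1) i
      have h3 := X_mul_boxFactor (x := x) (y := y) (lehmerCode N w i + 1) (i + 1)
      have h4 : subst (Equiv.swap (x i) (x (i + 1))) (boxFactor x y (lehmerCode N w i + 1) i)
          = boxFactor x y (lehmerCode N w i + 1) (i + 1) := by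
        simp [boxFactor, hyi]
      rw [demazure_spec, h4, h2, h3]
      ring
    rw [h1, one_mul]
  · rw [grothendieck_of_ascents_empty ha]
    congr 1
    refine boxProd_congr fun q hq => ?_
    rw [lehmerCode, Finset.filter_true_of_mem, Nat.card_Ioc]
    intro q' hq'
    rw [Finset.mem_Ioc] at hq'
    rw [apply_eq_of_ascents_empty hw ha hq, apply_eq_of_ascents_empty hw ha (q := q')
      ⟨by omega, by omega⟩]
    have := hq.2
    omega

end

/-! ### Zelevinsky permutations and their empty blocks -/

/-- The rightmost factor acts first, so the invariant `P` runs downwards from n to 0. -/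
theorem list_prod_range_apply {f : ℕ → Equiv.Perm ℕ} {P : ℕ → ℕ → Prop} {n : ℕ}
    (h : ∀ i < n, ∀ p, P (i + 1) p → P i (f i p)) {p : ℕ} (hp : P n p) :
    P 0 (((List.range n).map f).prod p) := by
  induction n generalizing p with
  | zero => simpa using hp
  | succ n ih =>
    rw [List.range_succ, List.map_append, List.prod_append, List.map_singleton,
      List.prod_singleton, Equiv.Perm.mul_apply]
    exact ih (fun i hi => h i (hi.trans (Nat.lt_succ_self n))) (h n (Nat.lt_succ_self n) p hp)

section blockSwap
variable {c x y p : ℕ}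

theorem blockSwap_apply : blockSwap c x y p = if c < p ∧ p ≤ c + y then p + x
    else if c + y < p ∧ p ≤ c + y + x then p - y else p := rfl

theorem blockSwap_apply_of_le (h : p ≤ c) : blockSwap c x y p = p := by
  rw [blockSwap_apply]; grind

theorem blockSwap_apply_of_lt (h : c + y + x < p) : blockSwap c x y p = p := by
  rw [blockSwap_apply]; grind

theorem blockSwap_apply_right (h1 : c + y < p) (h2 : p ≤ c + y + x) :
    blockSwap c x y p = p - y := by
  rw [blockSwap_apply]; grind

theorem blockSwap_apply_le {M : ℕ} (hM : c + y + x ≤ M) (h : p ≤ M) : blockSwap c x y p ≤ M := by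
  rw [blockSwap_apply]; grind

theorem one_le_blockSwap_apply (h : 1 ≤ p) : 1 ≤ blockSwap c x y p := by
  rw [blockSwap_apply]; grind

end blockSwap

theorem rankExt_of_le {r : ℕ → ℕ → ℕ} {i j : ℕ} (h : j ≤ i) :
    rankExt r i j = ∑ k ∈ Finset.Icc j i, r k k := if_pos h

theorem rankExt_of_lt {r : ℕ → ℕ → ℕ} {i j : ℕ} (h : i < j) : rankExt r i j = r i j :=
  if_neg (not_le.mpr h)

theorem rankExt_self {r : ℕ → ℕ → ℕ} (i : ℕ) : rankExt r i i = r i i := by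
  rw [rankExt_of_le le_rfl, Finset.Icc_self, Finset.sum_singleton]

theorem rankExt_of_succ_le {r : ℕ → ℕ → ℕ} {i j : ℕ} (h : j + 1 ≤ i) :
    rankExt r i j = r j j + rankExt r i (j + 1) := by
  rw [rankExt_of_le (by omega), rankExt_of_le h, ← Finset.insert_Icc_add_one_left_eq_Icc (by omega),
    Finset.sum_insert (by simp)]

theorem rankExt_succ_of_le {r : ℕ → ℕ → ℕ} {i j : ℕ} (h : j ≤ i) :
    rankExt r (i + 1) j = rankExt r i j + r (i + 1) (i + 1) := by
  rw [rankExt_of_le (by omega), rankExt_of_le h, Finset.sum_Icc_succ_top (by omega)]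

namespace IsRankConditions
variable {n : ℕ} {r : ℕ → ℕ → ℕ}

theorem rankExt_le_succ_left (hr : IsRankConditions n r) {i j : ℕ} (hj : j ≤ n) :
    rankExt r i j ≤ rankExt r (i + 1) j := by
  rcases lt_trichotomy (i + 1) j with h | rfl | h
  · rw [rankExt_of_lt h, rankExt_of_lt (by omega)]
    exact hr.le_right i j (by omega) hj
  · rw [rankExt_self, rankExt_of_lt (by omega)]
    exact hr.le_right i (i + 1) (by omega) hj
  · rw [rankExt_succ_of_le (by omega)]
    omega

theorem rankExt_succ_right_le (hr : IsRankConditions n r) {i j : ℕ} (hj : j + 1 ≤ n) :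
    rankExt r i (j + 1) ≤ rankExt r i j := by
  rcases lt_trichotomy i j with h | rfl | h
  · rw [rankExt_of_lt h, rankExt_of_lt (by omega)]
    exact hr.le_left i (j + 1) (by omega) hj
  · rw [rankExt_self, rankExt_of_lt (by omega)]
    exact hr.le_left i (i + 1) (by omega) hj
  · rw [rankExt_of_succ_le h]
    omega

/-- Strictly above the diagonal this is the given inequality. On the diagonal the defect is
r_{i,i+1} ≥ 0, and below it equality holds. -/
theorem rankExt_add_le (hr : IsRankConditions n r) {i j : ℕ} (hj : j + 1 ≤ n) :
    rankExt r i j + rankExt r (i + 1) (j + 1) ≤ rankExt r i (j + 1) + rankExt r (i + 1) j := by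
  rcases lt_trichotomy i j with h | rfl | h
  · have h1 : rankExt r (i + 1) j = r (i + 1) j := by
      rcases Nat.lt_or_eq_of_le (Nat.succ_le_of_lt h) with h' | h'
      · exact rankExt_of_lt h'
      · subst h'; exact rankExt_self _
    rw [h1, rankExt_of_lt h, rankExt_of_lt (by omega), rankExt_of_lt (by omega)]
    have := hr.le_add (i + 1) j (by omega) h (by omega)
    simp only [Nat.add_sub_cancel] at this
    omega
  · rw [rankExt_of_succ_le (r := r) (le_refl (i + 1)), rankExt_self, rankExt_self]
    omega
  · rw [rankExt_of_succ_le (r := r) (i := i) h,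
      rankExt_of_succ_le (r := r) (i := i + 1) (j := j) (by omega)]
    omega

theorem rankExt_mono (hr : IsRankConditions n r) {i i' j : ℕ} (hj : j ≤ n) (hi : i ≤ i') :
    rankExt r i j ≤ rankExt r i' j := by
  induction i', hi using Nat.le_induction with
  | base => exact le_rfl
  | succ i' _ ih => exact ih.trans (hr.rankExt_le_succ_left hj)

theorem rankExt_anti (hr : IsRankConditions n r) {i j j' : ℕ} (hj : j ≤ j') (hn : j' ≤ n) :
    rankExt r i j' ≤ rankExt r i j := by
  induction j', hj using Nat.le_induction with
  | base => exact le_rfl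
  | succ j' _ ih => exact (hr.rankExt_succ_right_le hn).trans (ih (by omega))

/-- The left side is the end of the interval moved by W_{i,j+1}; this is where the rank inequality
enters. -/
theorem zelBlock_support (hr : IsRankConditions n r) {i j : ℕ} (hj : j + 1 ≤ n) :
    rankExt r i (j + 1) + (rankExt r (i + 1) (j + 1) - rankExt r i (j + 1))
      + (rankExt r i j - rankExt r i (j + 1)) ≤ rankExt r (i + 1) j := by
  have h1 := hr.rankExt_le_succ_left (i := i) hj
  have h2 := hr.rankExt_succ_right_le (i := i) hj
  have h3 := hr.rankExt_add_le (i := i) hj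
  omega

theorem zelBlock_apply_of_lt (hr : IsRankConditions n r) {i j p : ℕ} (hj : j + 1 ≤ n)
    (hp : rankExt r (i + 1) j < p) : zelBlock r i (j + 1) p = p :=
  blockSwap_apply_of_lt (lt_of_le_of_lt (by simpa using hr.zelBlock_support hj) hp)

theorem zelBlock_apply_le (hr : IsRankConditions n r) {i j p M : ℕ} (hj : j + 1 ≤ n)
    (hM : rankExt r (i + 1) j ≤ M) (hp : p ≤ M) : zelBlock r i (j + 1) p ≤ M :=
  blockSwap_apply_le (le_trans (by simpa using hr.zelBlock_support hj) hM) hp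

theorem zelBlock_mem (hr : IsRankConditions n r) {i j p : ℕ} (hi : i < n) (hj : j < n)
    (hp : p ∈ Set.Icc 1 (totalDim n r)) :
    zelBlock r i (j + 1) p ∈ Set.Icc 1 (totalDim n r) :=
  ⟨one_le_blockSwap_apply hp.1, hr.zelBlock_apply_le hj
    ((hr.rankExt_mono hj.le hi).trans (hr.rankExt_anti (Nat.zero_le _) hj.le)) hp.2⟩

theorem mapsTo_conjZel (hr : IsRankConditions n r) :
    Set.MapsTo (conjZel n r) (Set.Icc 1 (totalDim n r)) (Set.Icc 1 (totalDim n r)) := by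
  intro p hp
  refine list_prod_range_apply (P := fun _ p => p ∈ Set.Icc 1 (totalDim n r))
    (fun j hj p hp => ?_) hp
  exact list_prod_range_apply (P := fun _ p => p ∈ Set.Icc 1 (totalDim n r))
    (fun i hi p hp => hr.zelBlock_mem hi hj hp) hp

/-- The conjugate Zelevinsky permutation has no values in the southeast of its block matrix. -/
theorem conjZel_apply_le (hr : IsRankConditions n r) {k m : ℕ} (hk : k ≤ n)
    (hm : rankExt r n k < m) (hmN : m ≤ totalDim n r) : conjZel n r m ≤ rankExt r k 0 := by
  have h1m : 1 ≤ m := by omega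
  have hN := (hr.mapsTo_conjZel ⟨h1m, hmN⟩).2
  -- The factors with j ≥ k fix every point above r_{nk}. For smaller j, each round puts the point
  -- either above r_{nj} or into the initial segment up to r_{kj}; at j = 0 the first alternative
  -- exceeds N.
  have key : (fun j p => if k ≤ j then rankExt r n k < p
      else rankExt r n j < p ∨ p ≤ rankExt r k j) 0 (conjZel n r m) := by
    refine list_prod_range_apply (n := n) (P := fun j p => if k ≤ j then rankExt r n k < p
      else rankExt r n j < p ∨ p ≤ rankExt r k j) (fun j hj p hp => ?_) (by rwa [if_pos hk])
    by_cases hkj : k ≤ j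
    · simp only [if_pos hkj, if_pos (hkj.trans (Nat.le_succ j))] at hp ⊢
      refine list_prod_range_apply (P := fun _ p => rankExt r n k < p) (fun i hi p hp => ?_) hp
      rwa [hr.zelBlock_apply_of_lt hj]
      exact lt_of_le_of_lt ((hr.rankExt_mono hj.le hi).trans (hr.rankExt_anti hkj hj.le)) hp
    · have hp' : rankExt r n (j + 1) < p ∨ p ≤ rankExt r k (j + 1) := by
        split_ifs at hp with h
        · obtain rfl : k = j + 1 := by omega
          exact Or.inl hp
        · exact hp
      simp only [if_neg hkj]
      -- Within a round, a point in the window from r_{n,j+1} to r_{nj}, of width e_j, is carried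
      -- down by each W_{i,j+1} with i ≥ k, past a block of size e_{i+1}, until it lies at most at
      -- r_{kj}. The factors with i < k preserve that initial segment.
      have h0 := list_prod_range_apply (n := n) (f := fun i => zelBlock r i (j + 1)) (p := p)
        (P := fun i p => if k ≤ i then rankExt r n j < p ∨ p ≤ rankExt r k (j + 1) ∨
            (rankExt r i (j + 1) < p ∧ p ≤ rankExt r i j)
          else rankExt r n j < p ∨ p ≤ rankExt r k j) (fun i hi p hp => ?_) ?_
      rotate_left
      · by_cases hki : k ≤ i
        · simp only [if_pos hki, if_pos (hki.trans (Nat.le_succ i))] at hp ⊢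
          rcases hp with hp | hp | hp
          · left
            rwa [hr.zelBlock_apply_of_lt hj]
            exact lt_of_le_of_lt (hr.rankExt_mono hj.le hi) hp
          · right; left
            rwa [zelBlock, blockSwap_apply_of_le (hp.trans (hr.rankExt_mono hj hki))]
          · right; right
            have e1 := rankExt_of_succ_le (r := r) (i := i) (j := j) (by omega)
            have e2 := rankExt_of_succ_le (r := r) (i := i + 1) (j := j) (by omega)
            have e3 := rankExt_succ_of_le (r := r) (i := i) (j := j + 1) (by omega)
            rw [zelBlock, Nat.add_sub_cancel, blockSwap_apply_right (by omega) (by omega)]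
            omega
        · have hp' : rankExt r n j < p ∨ p ≤ rankExt r k j := by
            have h1 := hr.rankExt_succ_right_le (i := k) hj
            split_ifs at hp with h
            · obtain rfl : k = i + 1 := by omega
              omega
            · exact hp
          simp only [if_neg hki]
          have h1 := hr.rankExt_mono (i := i + 1) (i' := k) hj.le (by omega)
          rcases hp' with hp' | hp'
          · left
            rwa [hr.zelBlock_apply_of_lt hj]
            exact lt_of_le_of_lt (hr.rankExt_mono hj.le hi) hp'
          · right
            exact hr.zelBlock_apply_le hj h1 hp'
      · simp only [if_pos hk]
        omega
      have h1 := hr.rankExt_succ_right_le (i := k) hj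
      split_ifs at h0 with hk0
      · obtain rfl : k = 0 := by omega
        omega
      · exact h0
  unfold totalDim at hN
  beta_reduce at key
  split_ifs at key with h
  · obtain rfl : k = 0 := by omega
    omega
  · omega

end IsRankConditions

/-! ### The block diagram below the graph of the Zelevinsky permutation -/

theorem longestPerm_apply {N p : ℕ} (hp : p ∈ Set.Icc 1 N) : longestPerm N p = N + 1 - p :=
  if_pos hp

theorem mapsTo_longestPerm (N : ℕ) : Set.MapsTo (longestPerm N) (Set.Icc 1 N) (Set.Icc 1 N) := by
  intro p hp
  rw [longestPerm_apply hp]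
  simp only [Set.mem_Icc] at hp ⊢
  omega

/-- The column lengths of the union of the blocks of size `e_j × e_i` for `i ≥ j + 2`, where the
columns are numbered from the last block. -/
def blockDiagram (n : ℕ) (e : ℕ → ℕ) (q : ℕ) : ℕ :=
  ∑ k ∈ Finset.range n, if q ≤ ∑ j ∈ Finset.Icc (k + 2) n, e j then e k else 0

theorem blockDiagram_anti (n : ℕ) (e : ℕ → ℕ) : Antitone (blockDiagram n e) := by
  intro q q' h
  refine Finset.sum_le_sum fun k _ => ?_
  split_ifs <;> omega

theorem sum_blockDiagram (n : ℕ) (e : ℕ → ℕ) :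
    ∑ q ∈ Finset.Icc 1 (∑ k ∈ Finset.Icc 0 n, e k), blockDiagram n e q
      = ∑ k ∈ Finset.range n, e k * ∑ j ∈ Finset.Icc (k + 2) n, e j := by
  simp only [blockDiagram]
  rw [Finset.sum_comm]
  refine Finset.sum_congr rfl fun k _ => ?_
  have h : ∑ j ∈ Finset.Icc (k + 2) n, e j ≤ ∑ k ∈ Finset.Icc 0 n, e k :=
    Finset.sum_le_sum_of_subset (Finset.Icc_subset_Icc_left (Nat.zero_le _))
  rw [← Finset.sum_filter, Finset.sum_const, smul_eq_mul, mul_comm]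
  congr 1
  rw [show (Finset.Icc 1 (∑ k ∈ Finset.Icc 0 n, e k)).filter
      (fun q => q ≤ ∑ j ∈ Finset.Icc (k + 2) n, e j)
      = Finset.Icc 1 (∑ j ∈ Finset.Icc (k + 2) n, e j) by
    ext q; simp only [Finset.mem_filter, Finset.mem_Icc]; omega]
  simp

theorem totalDim_eq (n : ℕ) (r : ℕ → ℕ → ℕ) : totalDim n r = ∑ k ∈ Finset.Icc 0 n, r k k :=
  rankExt_of_le (Nat.zero_le n)

theorem mapsTo_inv {w : Equiv.Perm ℕ} {N : ℕ} (h : Set.MapsTo w (Set.Icc 1 N) (Set.Icc 1 N)) :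
    Set.MapsTo (w⁻¹ : Equiv.Perm ℕ) (Set.Icc 1 N) (Set.Icc 1 N) := by
  intro p hp
  obtain ⟨q, hq, rfl⟩ := Finset.surjOn_of_injOn_of_card_le (s := Finset.Icc 1 N)
    (t := Finset.Icc 1 N) w (by simpa using h) w.injective.injOn le_rfl (by simpa using hp)
  rw [show (w⁻¹ : Equiv.Perm ℕ) (w q) = q from w.symm_apply_apply q]
  simpa using hq

theorem sum_Icc_add_sum_Icc {f : ℕ → ℕ} {k n : ℕ} (h : k ≤ n) :
    ∑ i ∈ Finset.Icc 0 k, f i + ∑ i ∈ Finset.Icc (k + 1) n, f i = ∑ i ∈ Finset.Icc 0 n, f i := by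
  rw [← Finset.sum_union (Finset.disjoint_left.mpr fun i => by
    simp only [Finset.mem_Icc]; omega)]
  congr 1
  ext i
  simp only [Finset.mem_union, Finset.mem_Icc]
  omega

theorem IsRankConditions.isBelowGraph {n : ℕ} {r : ℕ → ℕ → ℕ} (hr : IsRankConditions n r) :
    IsBelowGraph (totalDim n r) (blockDiagram n fun k => r k k) (zel n r) where
  mapsTo := ((mapsTo_longestPerm _).comp (mapsTo_inv hr.mapsTo_conjZel)).comp (mapsTo_longestPerm _)
  anti q _ _ := blockDiagram_anti _ _ (Nat.le_succ q)
  lt q h1 h2 := by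
    have hq := mapsTo_longestPerm _ ⟨h1, h2⟩
    have hm := mapsTo_inv hr.mapsTo_conjZel hq
    have hw : zel n r q = totalDim n r + 1
        - (conjZel n r)⁻¹ (longestPerm (totalDim n r) q) := longestPerm_apply hm
    have hz : conjZel n r ((conjZel n r)⁻¹ (longestPerm (totalDim n r) q))
        = totalDim n r + 1 - q := by
      exact ((conjZel n r).apply_symm_apply _).trans (longestPerm_apply ⟨h1, h2⟩)
    rw [hw]
    generalize (conjZel n r)⁻¹ (longestPerm (totalDim n r) q) = m at hm hz
    have hm1 := hm.1
    have hm2 := hm.2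
    by_contra! hcon
    have hne : ((Finset.range n).filter
        fun k => q ≤ ∑ j ∈ Finset.Icc (k + 2) n, r j j).Nonempty := by
      by_contra hne
      rw [Finset.not_nonempty_iff_eq_empty] at hne
      rw [blockDiagram, ← Finset.sum_filter, hne, Finset.sum_empty] at hcon
      omega
    -- K is the last block row that meets column q. If the value at q were at most the column
    -- length, then m > r_{n,K+1}, so z(m) ≤ r_{K+1,0}; but z(m) = N + 1 - q is larger, since q ≤
    -- e_{K+2} + ⋯ + e_n.
    obtain ⟨K, hK⟩ : ∃ K, K = Finset.max' _ hne := ⟨_, rfl⟩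
    have hKm := Finset.max'_mem _ hne
    rw [← hK, Finset.mem_filter, Finset.mem_range] at hKm
    have hle : blockDiagram n (fun k => r k k) q ≤ ∑ k ∈ Finset.Icc 0 K, r k k := by
      rw [blockDiagram, ← Finset.sum_filter]
      refine Finset.sum_le_sum_of_subset fun k hk => ?_
      rw [hK]
      exact Finset.mem_Icc.mpr ⟨Nat.zero_le _, Finset.le_max' _ k hk⟩
    have hs1 := sum_Icc_add_sum_Icc (f := fun k => r k k) (k := K) (n := n) (by omega)
    have hs2 := sum_Icc_add_sum_Icc (f := fun k => r k k) (k := K + 1) (n := n) (by omega)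
    have ht := totalDim_eq n r
    have hlast := hr.conjZel_apply_le (k := K + 1) (m := m) (by omega) (by
      rw [rankExt_of_le (by omega)]
      omega) hm2
    rw [hz, rankExt_of_le (Nat.zero_le _)] at hlast
    have := hKm.2
    rw [show K + 1 + 1 = K + 2 from rfl] at hs2
    omega

/-! ### Counting inversions: the denominator is a product -/

/-- The set of inversions of a permutation. -/
def invSet (w : Equiv.Perm ℕ) : Set (ℕ × ℕ) := {t | t.1 < t.2 ∧ w t.2 < w t.1}

/-- An inversion of u v that is not one of v is carried by v to an inversion of u. -/
theorem encard_invSet_mul_le (u v : Equiv.Perm ℕ) :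
    (invSet (u * v)).encard ≤ (invSet u).encard + (invSet v).encard := by
  have h : invSet (u * v) ⊆ (invSet (u * v) \ invSet v) ∪ invSet v := by simp
  refine (Set.encard_le_encard h).trans ((Set.encard_union_le _ _).trans (add_le_add ?_ le_rfl))
  refine Set.encard_le_encard_of_injOn (f := fun t : ℕ × ℕ => (v t.1, v t.2)) ?_ ?_
  · rintro ⟨p, q⟩ ⟨⟨h1, h2⟩, h3⟩
    have hne : v p ≠ v q := fun h => h1.ne (v.injective h)
    simp only [invSet, Set.mem_ofPred_eq, not_and, not_lt] at h1 h2 h3 ⊢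
    exact ⟨lt_of_le_of_ne (h3 h1) hne, h2⟩
  · rintro ⟨p, q⟩ _ ⟨p', q'⟩ _ h
    simpa using h

theorem encard_invSet_list_prod_le (f : ℕ → Equiv.Perm ℕ) (n : ℕ) :
    (invSet ((List.range n).map f).prod).encard
      ≤ ∑ i ∈ Finset.range n, (invSet (f i)).encard := by
  induction n with
  | zero =>
    have : invSet 1 = ∅ := by
      ext t
      simp only [invSet, Set.mem_ofPred_eq, Equiv.Perm.coe_one, id, Set.mem_empty_iff_false,
        iff_false]
      omega
    simp [this]
  | succ n ih =>
    rw [List.range_succ, List.map_append, List.prod_append, List.map_singleton,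
      List.prod_singleton, Finset.sum_range_succ]
    exact (encard_invSet_mul_le _ _).trans (by gcongr)

theorem encard_invSet_blockSwap_le (c x y : ℕ) :
    (invSet (blockSwap c x y)).encard ≤ ((x * y : ℕ) : ℕ∞) := by
  have h : invSet (blockSwap c x y)
      ⊆ ((Finset.Ioc c (c + y) ×ˢ Finset.Ioc (c + y) (c + y + x) : Finset (ℕ × ℕ)) :
        Set (ℕ × ℕ)) := by
    rintro ⟨p, q⟩ ⟨h1, h2⟩
    simp only [blockSwap_apply, Finset.coe_product, Set.mem_prod, Finset.coe_Ioc,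
      Set.mem_Ioc] at h1 h2 ⊢
    grind
  refine (Set.encard_le_encard h).trans ?_
  rw [Set.encard_coe_eq_coe_finsetCard, Finset.card_product, Nat.card_Ioc, Nat.card_Ioc]
  simp [mul_comm]

section maxRank
variable {r : ℕ → ℕ → ℕ}

theorem exists_maxRank_eq {i j : ℕ} (h : i ≤ j) : ∃ k ∈ Set.Icc i j, maxRank r i j = r k k := by
  obtain ⟨k, hk, hk'⟩ := Nat.sInf_mem (s := (fun k => r k k) '' Set.Icc i j)
    ⟨_, Set.mem_image_of_mem _ ⟨le_rfl, h⟩⟩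
  exact ⟨k, hk, hk'.symm⟩

theorem maxRank_le {i j k : ℕ} (h : k ∈ Set.Icc i j) : maxRank r i j ≤ r k k :=
  Nat.sInf_le (Set.mem_image_of_mem _ h)

theorem maxRank_self (i : ℕ) : maxRank r i i = r i i := by
  simp [maxRank]

theorem maxRank_mono {i j i' j' : ℕ} (h : i' ≤ j') (hi : i ≤ i') (hj : j' ≤ j) :
    maxRank r i j ≤ maxRank r i' j' := by
  obtain ⟨k, hk, hk'⟩ := exists_maxRank_eq (r := r) h
  rw [hk']
  exact maxRank_le ⟨hi.trans hk.1, hk.2.trans hj⟩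

/-- A minimum over an interval is attained after dropping one of its end points. Consequently one of
the two block lengths of W_{i,j+1} is zero for i ≤ j. -/
theorem maxRank_eq_or {i j : ℕ} (h : i ≤ j) :
    maxRank r i (j + 1) = maxRank r i j ∨ maxRank r i (j + 1) = maxRank r (i + 1) (j + 1) := by
  obtain ⟨k, hk, hk'⟩ := exists_maxRank_eq (r := r) (h.trans (Nat.le_succ j))
  have hk1 := hk.1
  have hk2 := hk.2
  rcases eq_or_ne k (j + 1) with rfl | hne
  · right
    refine le_antisymm (maxRank_mono (by omega) (by omega) le_rfl) ?_
    rw [hk']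
    exact maxRank_le ⟨by omega, le_rfl⟩
  · left
    refine le_antisymm (maxRank_mono h le_rfl (by omega)) ?_
    rw [hk']
    exact maxRank_le ⟨hk1, by omega⟩

theorem isRankConditions_maxRank (n : ℕ) (r : ℕ → ℕ → ℕ) : IsRankConditions n (maxRank r) where
  le_left i j h _ := maxRank_mono (by omega) le_rfl (by omega)
  le_right i j h _ := maxRank_mono (by omega) (by omega) le_rfl
  le_add i j h1 h2 _ := by
    obtain ⟨i, rfl⟩ : ∃ i', i = i' + 1 := ⟨i - 1, by omega⟩
    rw [Nat.add_sub_cancel]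
    have h3 := maxRank_mono (r := r) (i := i + 1) (i' := i + 1) (j := j + 1) (j' := j) h2 le_rfl
      (by omega)
    have h4 := maxRank_mono (r := r) (i := i) (i' := i + 1) (j := j) (j' := j) h2 (by omega) le_rfl
    rcases maxRank_eq_or (r := r) (i := i) (j := j) (by omega) with h | h <;> omega

theorem totalDim_maxRank (n : ℕ) : totalDim n (maxRank r) = totalDim n r := by
  rw [totalDim_eq, totalDim_eq]
  simp only [maxRank_self]

/-- For i ≤ j the factor is trivial; otherwise it exchanges adjacent blocks of sizes e_{i+1} and
e_j. These products are the sizes of the blocks in the block diagram. -/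
theorem encard_invSet_zelBlock_maxRank_le (i j : ℕ) :
    (invSet (zelBlock (maxRank r) i (j + 1))).encard
      ≤ ((if j + 1 ≤ i then r j j * r (i + 1) (i + 1) else 0 : ℕ) : ℕ∞) := by
  refine (encard_invSet_blockSwap_le _ _ _).trans (Nat.cast_le.mpr (le_of_eq ?_))
  rw [Nat.add_sub_cancel]
  split_ifs with h
  · rw [rankExt_of_succ_le h, rankExt_succ_of_le h, Nat.add_sub_cancel, Nat.add_sub_cancel_left,
      maxRank_self, maxRank_self]
  · have hj : ∀ l, l ≤ j → rankExt (maxRank r) l j = maxRank r l j := fun l hl => by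
      rcases hl.lt_or_eq with hl | rfl
      · exact rankExt_of_lt hl
      · rw [rankExt_self]
    have hj' : rankExt (maxRank r) (i + 1) (j + 1) = maxRank r (i + 1) (j + 1) := by
      rcases Nat.lt_or_ge i j with hl | hl
      · exact rankExt_of_lt (by omega)
      · obtain rfl : i = j := by omega
        rw [rankExt_self]
    rw [hj i (by omega), hj', rankExt_of_lt (show i < j + 1 by omega)]
    rcases maxRank_eq_or (r := r) (i := i) (j := j) (by omega) with h | h <;> simp [h]

theorem encard_invSet_conjZel_maxRank_le (n : ℕ) :
    (invSet (conjZel n (maxRank r))).encard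
      ≤ ((∑ k ∈ Finset.range n, r k k * ∑ j ∈ Finset.Icc (k + 2) n, r j j : ℕ) : ℕ∞) := by
  refine (encard_invSet_list_prod_le _ n).trans ?_
  rw [Nat.cast_sum]
  refine Finset.sum_le_sum fun j _ => (encard_invSet_list_prod_le _ n).trans ?_
  refine (Finset.sum_le_sum fun i _ => encard_invSet_zelBlock_maxRank_le i j).trans ?_
  rw [← Nat.cast_sum, ← Finset.sum_filter, Finset.mul_sum]
  refine Nat.cast_le.mpr (le_of_eq ?_)
  refine Finset.sum_nbij' (fun i => i + 1) (fun i => i - 1) ?_ ?_ ?_ ?_ fun _ _ => rfl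
  all_goals
    intro i hi
    simp only [Finset.mem_filter, Finset.mem_range, Finset.mem_Icc] at hi ⊢
    omega

end maxRank

/-- Each value p ≤ lam q occurs to the right of q: at a position q' ≤ q it would satisfy p = w q' >
lam q' ≥ lam q. -/
theorem IsBelowGraph.le_lehmerCode {N : ℕ} {lam : ℕ → ℕ} {w : Equiv.Perm ℕ}
    (h : IsBelowGraph N lam w) {q : ℕ} (hq : q ∈ Set.Icc 1 N) : lam q ≤ lehmerCode N w q := by
  have h0 : lam q = (Finset.Icc 1 (lam q)).card := by simp
  rw [h0, lehmerCode]
  refine Finset.card_le_card_of_injOn (w⁻¹ : Equiv.Perm ℕ) (fun p hp => ?_)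
    (w⁻¹ : Equiv.Perm ℕ).injective.injOn
  simp only [Finset.coe_Icc, Set.mem_Icc] at hp
  have hlt := h.lt q hq.1 hq.2
  have hle := h.le q hq
  have hm := mapsTo_inv h.mapsTo (show p ∈ Set.Icc 1 N from ⟨hp.1, hp.2.trans hle⟩)
  have hw : w ((w⁻¹ : Equiv.Perm ℕ) p) = p := w.apply_symm_apply p
  generalize (w⁻¹ : Equiv.Perm ℕ) p = q' at hm hw
  simp only [Finset.coe_filter, Finset.mem_Ioc, Set.mem_ofPred_eq]
  refine ⟨⟨?_, hm.2⟩, by omega⟩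
  by_contra! hcon
  have h1 := h.antitoneOn hm.1 hcon hq.2
  have h2 := h.lt q' hm.1 hm.2
  omega

/-- A permutation with as many inversions as boxes in a diagram below its graph is dominant. -/
theorem IsBelowGraph.grothendieck_eq {N : ℕ} {x y : ℕ → QVar} (hd : DistinctVars N x y)
    {lam : ℕ → ℕ} {w : Equiv.Perm ℕ} (h : IsBelowGraph N lam w)
    (hsum : ∑ q ∈ Finset.Icc 1 N, lehmerCode N w q ≤ ∑ q ∈ Finset.Icc 1 N, lam q) :
    grothendieck N x y w = toRat (boxProd N x y lam) := by
  have hle : ∀ q ∈ Finset.Icc 1 N, lam q ≤ lehmerCode N w q := fun q hq =>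
    h.le_lehmerCode (by simpa using hq)
  have heq := (Finset.sum_eq_sum_iff_of_le hle).mp (le_antisymm (Finset.sum_le_sum hle) hsum)
  have heq' : ∀ q ∈ Set.Icc 1 N, lehmerCode N w q = lam q := fun q hq =>
    (heq q (by simpa using hq)).symm
  rw [grothendieck_of_lehmerCode_anti hd h.mapsTo, boxProd_congr heq']
  intro q h1 h2
  rw [heq' _ ⟨Nat.le_add_left _ _, h2⟩, heq' _ ⟨h1, h2.le⟩]
  exact h.anti q h1 h2

/-- The sum of the code counts inversions. Inversion exchanges positions and values, and both
conjugating factors reverse the order, so inversions go injectively to inversions of z. -/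
theorem sum_lehmerCode_le_encard_invSet {N : ℕ} {z : Equiv.Perm ℕ}
    (hz : Set.MapsTo z (Set.Icc 1 N) (Set.Icc 1 N)) :
    ((∑ q ∈ Finset.Icc 1 N, lehmerCode N (longestPerm N * z⁻¹ * longestPerm N) q : ℕ) : ℕ∞)
      ≤ (invSet z).encard := by
  simp only [lehmerCode]
  rw [← Finset.card_sigma, ← Set.encard_coe_eq_coe_finsetCard]
  refine Set.encard_le_encard_of_injOn
    (f := fun t => (z⁻¹ (longestPerm N t.1), z⁻¹ (longestPerm N t.2))) ?_ ?_
  · rintro ⟨q, q'⟩ hq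
    rw [Finset.mem_coe, Finset.mem_sigma, Finset.mem_filter, Finset.mem_Icc,
      Finset.mem_Ioc] at hq
    obtain ⟨hq1, ⟨hlt, hq2⟩, hlt'⟩ := hq
    simp only [Equiv.Perm.mul_apply] at hq1 hlt hq2 hlt'
    have hq2' : q' ∈ Set.Icc 1 N := ⟨by omega, hq2⟩
    have hm1 := mapsTo_inv hz (mapsTo_longestPerm N hq1)
    have hm2 := mapsTo_inv hz (mapsTo_longestPerm N hq2')
    rw [longestPerm_apply hm1, longestPerm_apply hm2] at hlt'
    refine ⟨by dsimp only; omega, ?_⟩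
    change z (z.symm (longestPerm N q')) < z (z.symm (longestPerm N q))
    rw [Equiv.apply_symm_apply, Equiv.apply_symm_apply, longestPerm_apply hq1,
      longestPerm_apply hq2']
    have := hq1.2
    omega
  · rintro ⟨q, q'⟩ _ ⟨p, p'⟩ _ h
    simpa using h

/-- The denominator of the double ratio formula is a product over the block diagram. -/
theorem ratioDen_eq {n : ℕ} {r : ℕ → ℕ → ℕ}
    (hd : DistinctVars (totalDim n r) (aRev n r) (bSeq n r)) :
    ratioDen n r = toRat (boxProd (totalDim n r) (aRev n r) (bSeq n r)
      (blockDiagram n fun k => r k k)) := by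
  have hr := isRankConditions_maxRank n r
  have h := hr.isBelowGraph
  simp only [totalDim_maxRank, maxRank_self] at h
  refine h.grothendieck_eq hd ?_
  rw [totalDim_eq, sum_blockDiagram, ← totalDim_eq]
  refine Nat.cast_le.mp (le_trans ?_ (encard_invSet_conjZel_maxRank_le (r := r) n))
  rw [zel, totalDim_maxRank]
  have hz := hr.mapsTo_conjZel
  rw [totalDim_maxRank] at hz
  exact sum_lehmerCode_le_encard_invSet hz

/-! ### Positions of the variables in the two sequences -/

theorem injOn_seqOfList {l : List QVar} (h : l.Nodup) :
    Set.InjOn (seqOfList l) (Set.Icc 1 l.length) := by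
  intro p hp q hq hpq
  simp only [Set.mem_Icc] at hp hq
  rw [seqOfList, seqOfList, List.getD_eq_getElem _ _ (by omega),
    List.getD_eq_getElem _ _ (by omega), h.getElem_inj_iff] at hpq
  omega

theorem seqOfList_mem {l : List QVar} {p : ℕ} (hp : p ∈ Set.Icc 1 l.length) :
    seqOfList l p ∈ l := by
  simp only [Set.mem_Icc] at hp
  rw [seqOfList, List.getD_eq_getElem _ _ (by omega)]
  exact List.getElem_mem _

theorem seqOfList_append_cons (l l' : List QVar) (v : QVar) :
    seqOfList (l ++ v :: l') (l.length + 1) = v := by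
  simp [seqOfList]

section
variable {f : ℕ → ℕ → QVar}

theorem nodup_flatMap_map_range (hf : ∀ i j i' j', f i j = f i' j' → i = i' ∧ j = j')
    {l : List ℕ} (hl : l.Nodup) (e : ℕ → ℕ) :
    (l.flatMap fun i => (List.range (e i)).map fun j => f i (j + 1)).Nodup := by
  rw [List.nodup_flatMap]
  refine ⟨fun i _ => List.Nodup.map (fun j j' h => ?_) List.nodup_range, hl.imp fun hne => ?_⟩
  · have := (hf _ _ _ _ h).2
    omega
  · rw [Function.onFun, List.disjoint_left]
    intro v hv hv'
    obtain ⟨j, -, rfl⟩ := List.mem_map.mp hv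
    obtain ⟨j', -, h⟩ := List.mem_map.mp hv'
    exact hne (hf _ _ _ _ h).1.symm

theorem sum_map_range' (e : ℕ → ℕ) (s m : ℕ) :
    ((List.range' s m).map e).sum = ∑ k ∈ Finset.Ico s (s + m), e k := by
  induction m with
  | zero => simp
  | succ m ih =>
    rw [List.range'_concat, List.map_append, List.sum_append, ih, ← add_assoc,
      Finset.sum_Ico_succ_top (by omega)]
    simp

theorem length_flatMap_range' (e : ℕ → ℕ) (s m : ℕ) :
    ((List.range' s m).flatMap fun i => (List.range (e i)).map fun j => f i (j + 1)).length
      = ∑ k ∈ Finset.Ico s (s + m), e k := by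
  rw [List.length_flatMap, ← sum_map_range']
  simp

theorem length_flatMap_range'_reverse (e : ℕ → ℕ) (s m : ℕ) :
    ((List.range' s m).reverse.flatMap
      fun i => (List.range (e i)).map fun j => f i (j + 1)).length
      = ∑ k ∈ Finset.Ico s (s + m), e k := by
  rw [List.length_flatMap, ← sum_map_range', List.map_reverse, List.sum_reverse]
  simp

end

section
variable (n : ℕ) (r : ℕ → ℕ → ℕ)

theorem range_succ_eq_append {n i : ℕ} (h : i ≤ n) :
    List.range (n + 1) = List.range' 0 i ++ i :: List.range' (i + 1) (n - i) := by
  have := List.range'_append (s := 0) (m := i) (n := n - i + 1) (step := 1)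
  rw [one_mul, zero_add, show i + (n - i + 1) = n + 1 by omega] at this
  rw [List.range_eq_range', ← List.range'_succ, this]

theorem bSeq_ne_aRev {n : ℕ} {r : ℕ → ℕ → ℕ} (i j : ℕ) :
    ∀ q ∈ Set.Icc 1 (totalDim n r), QVar.b i j ≠ aRev n r q := by
  intro q hq h
  have hN : totalDim n r = ∑ k ∈ Finset.Ico 0 (0 + (n + 1)), r k k := by
    rw [totalDim_eq]; congr 1; ext k; simp only [Finset.mem_Icc, Finset.mem_Ico]; omega
  have ha := length_flatMap_range'_reverse (f := QVar.a) (fun k => r k k) 0 (n + 1)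
  rw [← hN, ← List.range_eq_range'] at ha
  have hq' := seqOfList_mem (ha.symm ▸ hq)
  rw [← aRev, ← h] at hq'
  simp [List.mem_flatMap, List.mem_map] at hq'

theorem distinctVars_aRev_bSeq : DistinctVars (totalDim n r) (aRev n r) (bSeq n r) := by
  have hN : totalDim n r = ∑ k ∈ Finset.Ico 0 (0 + (n + 1)), r k k := by
    rw [totalDim_eq]; congr 1; ext k; simp only [Finset.mem_Icc, Finset.mem_Ico]; omega
  have ha := length_flatMap_range'_reverse (f := QVar.a) (fun k => r k k) 0 (n + 1)
  have hb := length_flatMap_range' (f := QVar.b) (fun k => r k k) 0 (n + 1)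
  rw [← hN, ← List.range_eq_range'] at ha hb
  refine ⟨?_, ?_, fun q p hq hp h => ?_⟩
  · rw [← ha]
    exact injOn_seqOfList (nodup_flatMap_map_range (fun _ _ _ _ h => by simpa using h)
      (List.nodup_reverse.mpr List.nodup_range) _)
  · rw [← hb]
    exact injOn_seqOfList (nodup_flatMap_map_range (fun _ _ _ _ h => by simpa using h)
      List.nodup_range _)
  · obtain ⟨i, -, hi⟩ := List.mem_flatMap.mp (seqOfList_mem (hb.symm ▸ hp))
    obtain ⟨j, -, hj⟩ := List.mem_map.mp hi
    exact bSeq_ne_aRev i (j + 1) q hq (hj.trans h.symm)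

variable {n r}

theorem aRev_apply {i : ℕ} (hi : i ≤ n) (h : 1 ≤ r i i) :
    aRev n r (∑ j ∈ Finset.Icc (i + 1) n, r j j + 1) = QVar.a i 1 := by
  have hl := length_flatMap_range'_reverse (f := QVar.a) (fun k => r k k) (i + 1) (n - i)
  rw [show Finset.Icc (i + 1) n = Finset.Ico (i + 1) (i + 1 + (n - i)) by
    ext k; simp only [Finset.mem_Icc, Finset.mem_Ico]; omega, ← hl, aRev, range_succ_eq_append hi,
    List.reverse_append, List.reverse_cons, List.append_assoc, List.flatMap_append,
    List.singleton_append, List.flatMap_cons]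
  obtain ⟨m, hm⟩ : ∃ m, r i i = m + 1 := ⟨r i i - 1, by omega⟩
  rw [hm, List.range_succ_eq_map, List.map_cons, List.cons_append]
  exact seqOfList_append_cons _ _ _

theorem bSeq_apply {i : ℕ} (hi : i ≤ n) (h : 1 ≤ r i i) :
    bSeq n r (∑ j ∈ Finset.range i, r j j + 1) = QVar.b i 1 := by
  have hl := length_flatMap_range' (f := QVar.b) (fun k => r k k) 0 i
  rw [Finset.range_eq_Ico, show Finset.Ico 0 i = Finset.Ico 0 (0 + i) by rw [zero_add], ← hl,
    bSeq, range_succ_eq_append hi, List.flatMap_append, List.flatMap_cons]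
  obtain ⟨m, hm⟩ : ∃ m, r i i = m + 1 := ⟨r i i - 1, by omega⟩
  rw [hm, List.range_succ_eq_map, List.map_cons, List.cons_append]
  exact seqOfList_append_cons _ _ _

end

/-! ### Addable boxes of the block diagram and the conclusion -/

/-- Since e_{i+1} ≥ 1, this column is the first one of block i + 1, which meets exactly the block
rows k with k + 2 ≤ i + 1, apart from empty ones. -/
theorem blockDiagram_corner {n i : ℕ} {e : ℕ → ℕ} (hi : i < n) (h : 1 ≤ e (i + 1)) :
    blockDiagram n e (∑ j ∈ Finset.Icc (i + 2) n, e j + 1) = ∑ j ∈ Finset.range i, e j := by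
  rw [blockDiagram, ← Finset.sum_filter]
  congr 1
  ext k
  simp only [Finset.mem_filter, Finset.mem_range]
  constructor
  · rintro ⟨-, hk⟩
    by_contra! hik
    have := Finset.sum_le_sum_of_subset (f := e)
      (Finset.Icc_subset_Icc_left (b := n) (show i + 2 ≤ k + 2 by omega))
    omega
  · intro hk
    refine ⟨by omega, ?_⟩
    have h1 := Finset.sum_le_sum_of_subset (f := e)
      (Finset.Icc_subset_Icc_left (b := n) (show k + 2 ≤ i + 1 by omega))
    rw [← Finset.insert_Icc_add_one_left_eq_Icc (show i + 1 ≤ n by omega),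
      Finset.sum_insert (by simp)] at h1
    rw [show i + 1 + 1 = i + 2 from rfl] at h1
    omega

/-- The threshold of block row i is attained with equality here, so the column contains that
nonempty block row. Together with `blockDiagram_corner` this makes the next box addable. -/
theorem lt_blockDiagram {n i : ℕ} {e : ℕ → ℕ} (hi : i < n) (h : 1 ≤ e i) :
    ∑ j ∈ Finset.range i, e j < blockDiagram n e (∑ j ∈ Finset.Icc (i + 2) n, e j) := by
  rw [blockDiagram, ← Finset.sum_filter]
  refine lt_of_lt_of_le (b := ∑ j ∈ Finset.range (i + 1), e j)
    (by rw [Finset.sum_range_succ]; omega) (Finset.sum_le_sum_of_subset fun k hk => ?_)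
  rw [Finset.mem_range] at hk
  simp only [Finset.mem_filter, Finset.mem_range]
  exact ⟨by omega, Finset.sum_le_sum_of_subset (Finset.Icc_subset_Icc_left (by omega))⟩

theorem theoremT (n : ℕ) (r : ℕ → ℕ → ℕ) (hr : IsRankConditions n r) :
    ratioDen n r ≠ 0 ∧
    ∃ P : QLaurent, QLaurent.toRat P = doubleQuiver n r ∧
      ∀ i, i < n → 1 ≤ r i i → 1 ≤ r (i + 1) (i + 1) →
        (QLaurent.setVar (QVar.a (i + 1) 1) (QVar.b i 1) P).IndependentOf (QVar.b i 1) := by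
  have hd := distinctVars_aRev_bSeq n r
  have hb := hr.isBelowGraph
  have hden := ratioDen_eq hd
  have hne : ratioDen n r ≠ 0 := by
    rw [hden, ← map_zero toRat]
    exact fun h => boxProd_ne_zero hd hb.le (toRat_injective h)
  obtain ⟨F, hF⟩ := hb.exists_eq_mul_boxProd hd
  refine ⟨hne, F, ?_, fun i hi h1 h2 => ?_⟩
  · rw [doubleQuiver, eq_div_iff hne, hden, ← map_mul]
    exact hF
  · have hq : ∑ j ∈ Finset.Icc (i + 2) n, r j j + 1 ∈ Set.Icc 1 (totalDim n r) := by
      refine ⟨Nat.le_add_left _ _, ?_⟩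
      have hs := sum_Icc_add_sum_Icc (f := fun k => r k k) (k := i + 1) (n := n) hi
      have h3 : r (i + 1) (i + 1) ≤ ∑ k ∈ Finset.Icc 0 (i + 1), r k k :=
        Finset.single_le_sum (f := fun k => r k k) (fun _ _ => Nat.zero_le _) (by simp)
      rw [totalDim_eq]
      rw [show i + 1 + 1 = i + 2 from rfl] at hs
      omega
    have hc := blockDiagram_corner (e := fun k => r k k) hi h2
    -- For i + 1 = n the column is q = 1, and the corner condition is still met at the fictitious
    -- column 0, where the length is e_0 + ⋯ + e_{n-1}. The dummy variable b^0_0 serves as the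
    -- second target for the common value.
    have key := hb.subst_mergeVar_eq hd hF hq
      (Or.inr (by rw [hc, Nat.add_sub_cancel]; exact lt_blockDiagram hi h1))
      (bSeq_ne_aRev 0 0) (bSeq_ne_aRev i 1)
    rw [hc, aRev_apply hi h2, bSeq_apply hi.le h1] at key
    -- Renaming b^i_1 to the dummy variable after the specialization sends both merged variables to
    -- the dummy; by `key` this changes nothing.
    refine independentOf_of_subst_eq (v := QVar.b 0 0) (by simp) ?_
    rw [setVar_eq_subst, subst_subst]
    convert key using 2
    · congr 1
      funext t
      simp only [Function.comp, mergeVar]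
      grind
    · congr 1
      funext t
      simp only [mergeVar]
      grind
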